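/- Let $L^2(\mathbb R)$ be the real-valued square-integrable functions, $H^{1/2}(\mathbb R)$ the set of $u\in L^2(\mathbb R)$ with $[u]^2=\int_{\mathbb R^2}\frac{(u(x)-u(y))^2}{|x-y|^2}\,dx\,dy<\infty$, and let $X=\{u\in H^{1/2}(\mathbb R): u=0 \text{ a.e. in } \mathbb R\setminus(0,1)\}$, a normed space with the norm $\|u\|_X=[u]$. Let $\omega$ be the optimal constant of the Trudinger–Moser inequality on $H^{1/2}(\mathbb R)$, that is, the supremum of all $w\in(0,\pi]$ such that for every $0<\alpha<w$ there is $H_\alpha>0$ with $$\int_{\mathbb R}\big(e^{\alpha u^2}-1\big)\,dx\le H_\alpha\|u\|_{L^2(\mathbb R)}^2\qquad\text{for all } u\in H^{1/2}(\mathbb R) \text{ with } \|(-\Delta)^{1/4}u\|_{L^2(\mathbb R)}\le 1,$$ where $(-\Delta)^{1/4}$ is the Fourier multiplier with symbol $|2\pi\xi|^{1/2}$ for $\hat u(\xi)=\int_{\mathbb R} e^{-2\pi i x\xi}u(x)\,dx$. Let $\lambda_1=\inf\{\|u\|_X^2: u\in X,\ \|u\|_{L^2(0,1)}=1\}$. Let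 $f:\mathbb R\to\mathbb R$ be continuous with $f(0)=0$, put $F(t)=\int_0^t f(\tau)\,d\tau$, and assume ${\bf H'}$: (i) there are $t_0,M>0$ with $0<F(t)\le M|f(t)|$ for all $|t|\ge t_0$; (ii) $0<2F(t)\le f(t)t$ for all $t\ne0$; (iii) $\limsup_{t\to0}\frac{F(t)}{t^2}<\frac{\lambda_1}{4\pi}$; (iv) $\alpha_0$ is a number with $0<\alpha_0<2\pi\omega$ such that, as $|t|\to\infty$, $\frac{|f(t)|}{e^{\alpha t^2}}\to\infty$ if $0<\alpha<\alpha_0$ and $\frac{|f(t)|}{e^{\alpha t^2}}\to0$ if $\alpha>\alpha_0$; (v) there is $\psi\in X$ with $\|\psi\|_X=1$ and $\sup_{t>0}\Big(\frac{t^2}{4\pi}-\int_0^1F(t\psi)\,dx\Big)<\frac{\omega}{2\alpha_0}$. Then the functional $\varphi:X\to\mathbb R$, $\varphi(u)=\frac{\|u\|_X^2}{4\pi}-\int_0^1F(u)\,dx$, satisfies the Palais–Smale condition at every level $c<\frac{\omega}{2\alpha_0}$: every sequence $(u_n)$ in $X$ with $\varphi(u_n)\to c$ and $\varphi'(u_n)\to0$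 in $X^*$ (where $\varphi'$ is the Fréchet derivative of $\varphi$ on $X$) has a subsequence that converges in $X$. -/

import Mathlib

open MeasureTheory Filter Topology
open scoped ENNReal FourierTransform

noncomputable section

namespace HalfLap

/-- The space `L²(ℝ)` of real-valued functions (modulo equality almost everywhere). -/
abbrev L2R : Type := Lp ℝ 2 (volume : Measure ℝ)

/-- The integrand `(u(x) - u(y)) (v(x) - v(y)) / |x - y|²` of the Gagliardo form. -/
def gagliardoIntegrand (u v : ℝ → ℝ) (p : ℝ × ℝ) : ℝ :=
  (u p.1 - u p.2) * (v p.1 - v p.2) / |p.1 - p.2| ^ 2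

/-- Membership in `H^{1/2}(ℝ)`: a function `u ∈ L²(ℝ)` for which the integral over `ℝ²` of
`(u(x) - u(y))² / |x - y|²` is finite. -/
def MemHHalf (u : L2R) : Prop :=
  Integrable (gagliardoIntegrand u u) (volume : Measure (ℝ × ℝ))

/-- The difference quotient, whose square is the Gagliardo integrand. -/
def diffQuot (u : ℝ → ℝ) (p : ℝ × ℝ) : ℝ := (u p.1 - u p.2) / |p.1 - p.2|

lemma gagliardoIntegrand_eq (u v : ℝ → ℝ) (p : ℝ × ℝ) :
    gagliardoIntegrand u v p = diffQuot u p * diffQuot v p := by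
  simp only [gagliardoIntegrand, diffQuot, div_mul_div_comm, sq]

lemma diffQuot_congr {u v : ℝ → ℝ} (h : u =ᵐ[volume] v) :
    diffQuot u =ᵐ[(volume : Measure (ℝ × ℝ))] diffQuot v := by
  have h1 : ∀ᵐ p : ℝ × ℝ, u p.1 = v p.1 :=
    (Measure.quasiMeasurePreserving_fst (μ := (volume : Measure ℝ))
      (ν := (volume : Measure ℝ))).ae h
  have h2 : ∀ᵐ p : ℝ × ℝ, u p.2 = v p.2 :=
    (Measure.quasiMeasurePreserving_snd (μ := (volume : Measure ℝ))
      (ν := (volume : Measure ℝ))).ae h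
  filter_upwards [h1, h2] with p hp1 hp2
  simp [diffQuot, hp1, hp2]

lemma diffQuot_aesm (u : L2R) :
    AEStronglyMeasurable (diffQuot u) (volume : Measure (ℝ × ℝ)) := by
  have hu : AEStronglyMeasurable (u : ℝ → ℝ) volume := Lp.aestronglyMeasurable u
  have h1 : AEMeasurable (fun p : ℝ × ℝ => u p.1) volume :=
    (hu.comp_quasiMeasurePreserving (Measure.quasiMeasurePreserving_fst
      (μ := (volume : Measure ℝ)) (ν := (volume : Measure ℝ)))).aemeasurable
  have h2 : AEMeasurable (fun p : ℝ × ℝ => u p.2) volume :=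
    (hu.comp_quasiMeasurePreserving (Measure.quasiMeasurePreserving_snd
      (μ := (volume : Measure ℝ)) (ν := (volume : Measure ℝ)))).aemeasurable
  have h3 : Measurable (fun p : ℝ × ℝ => |p.1 - p.2|) := by fun_prop
  exact ((h1.sub h2).div h3.aemeasurable).aestronglyMeasurable

lemma memHHalf_iff (u : L2R) :
    MemHHalf u ↔ MemLp (diffQuot u) 2 (volume : Measure (ℝ × ℝ)) := by
  rw [memLp_two_iff_integrable_sq (diffQuot_aesm u)]
  unfold MemHHalf
  have : gagliardoIntegrand u u = fun p => diffQuot u p ^ 2 := by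
    funext p; rw [gagliardoIntegrand_eq, sq]
  rw [this]

lemma diffQuot_add (u v : L2R) :
    diffQuot (u + v : L2R) =ᵐ[(volume : Measure (ℝ × ℝ))] diffQuot u + diffQuot v := by
  refine (diffQuot_congr (Lp.coeFn_add u v)).trans (Eventually.of_forall fun p => ?_)
  simp only [diffQuot, Pi.add_apply]; ring

lemma diffQuot_smul (c : ℝ) (u : L2R) :
    diffQuot (c • u : L2R) =ᵐ[(volume : Measure (ℝ × ℝ))] c • diffQuot u := by
  refine (diffQuot_congr (Lp.coeFn_smul c u)).trans (Eventually.of_forall fun p => ?_)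
  simp only [diffQuot, Pi.smul_apply, smul_eq_mul]; ring

/-- The functions of `H^{1/2}(ℝ)` that vanish almost everywhere outside `(0,1)`, as a linear
subspace of `L²(ℝ)`. -/
def xSubmodule : Submodule ℝ L2R where
  carrier := {u | MemHHalf u ∧ ∀ᵐ x : ℝ, x ∉ Set.Ioo (0 : ℝ) 1 → u x = 0}
  add_mem' := by
    rintro u v ⟨hu, hu0⟩ ⟨hv, hv0⟩
    refine ⟨?_, ?_⟩
    · rw [memHHalf_iff] at *
      exact (memLp_congr_ae (diffQuot_add u v)).2 (hu.add hv)
    · filter_upwards [hu0, hv0, Lp.coeFn_add u v] with x h1 h2 h3 hx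
      rw [h3, Pi.add_apply, h1 hx, h2 hx, add_zero]
  zero_mem' := by
    refine ⟨?_, ?_⟩
    · rw [memHHalf_iff]
      have h : diffQuot (0 : L2R) =ᵐ[(volume : Measure (ℝ × ℝ))] 0 := by
        refine (diffQuot_congr (Lp.coeFn_zero ℝ 2 volume)).trans
          (Eventually.of_forall fun p => ?_)
        simp [diffQuot]
      exact (memLp_congr_ae h).2 MemLp.zero
    · filter_upwards [Lp.coeFn_zero ℝ 2 (volume : Measure ℝ)] with x h _
      rw [h, Pi.zero_apply]
  smul_mem' := by
    rintro c u ⟨hu, hu0⟩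
    refine ⟨?_, ?_⟩
    · rw [memHHalf_iff] at *
      exact (memLp_congr_ae (diffQuot_smul c u)).2 (hu.const_smul c)
    · filter_upwards [hu0, Lp.coeFn_smul c u] with x h1 h2 hx
      rw [h2, Pi.smul_apply, h1 hx, smul_zero]

/-- The space `X = {u ∈ H^{1/2}(ℝ) : u = 0 in ℝ ∖ (0,1)}`. It is a type synonym of the subspace
above, so that it carries the Gagliardo norm and not the norm of `L²(ℝ)`. -/
def X : Type := xSubmodule

instance : AddCommGroup X := inferInstanceAs (AddCommGroup xSubmodule)
instance : Module ℝ X := inferInstanceAs (Module ℝ xSubmodule)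

/-- The underlying element of `L²(ℝ)`. -/
def X.toL2 : X →ₗ[ℝ] L2R := xSubmodule.subtype

instance : CoeFun X (fun _ => ℝ → ℝ) := ⟨fun u => (X.toL2 u : ℝ → ℝ)⟩

lemma X.memLp_diffQuot (u : X) :
    MemLp (diffQuot (X.toL2 u)) 2 (volume : Measure (ℝ × ℝ)) :=
  (memHHalf_iff _).1 u.2.1

lemma X.integrable_gagliardo (u v : X) :
    Integrable (gagliardoIntegrand u v) (volume : Measure (ℝ × ℝ)) := by
  have h : gagliardoIntegrand u v = fun p => diffQuot u p * diffQuot v p := by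
    funext p; exact gagliardoIntegrand_eq _ _ p
  rw [h]
  exact MemLp.integrable_mul (X.memLp_diffQuot u) (X.memLp_diffQuot v)

/-- The scalar product `⟨u,v⟩_X`, the integral over `ℝ²` of
`(u(x) - u(y)) (v(x) - v(y)) / |x - y|²`. -/
def innerX (u v : X) : ℝ := ∫ p : ℝ × ℝ, gagliardoIntegrand u v p

/-- `⟨·,·⟩_X` is a scalar product on `X`. -/
@[reducible] def coreX : InnerProductSpace.Core ℝ X where
  inner := innerX
  conj_inner_symm u v := by
    change innerX v u = innerX u v
    unfold innerX
    congr 1; funext p; simp only [gagliardoIntegrand]; ring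
  re_inner_nonneg u := by
    change 0 ≤ innerX u u
    refine integral_nonneg fun p => ?_
    rw [gagliardoIntegrand_eq]
    exact mul_self_nonneg _
  add_left u v w := by
    change innerX (u + v) w = innerX u w + innerX v w
    unfold innerX
    rw [← integral_add (X.integrable_gagliardo u w) (X.integrable_gagliardo v w)]
    refine integral_congr_ae ?_
    have h := diffQuot_add (X.toL2 u) (X.toL2 v)
    rw [← map_add] at h
    filter_upwards [h] with p hp
    simp only [gagliardoIntegrand_eq, hp, Pi.add_apply]; ring
  smul_left u v r := by
    change innerX (r • u) v = r * innerX u v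
    unfold innerX
    rw [← integral_const_mul]
    refine integral_congr_ae ?_
    have h := diffQuot_smul r (X.toL2 u)
    rw [← map_smul] at h
    filter_upwards [h] with p hp
    simp only [gagliardoIntegrand_eq, hp, Pi.smul_apply, smul_eq_mul]; ring
  definite u hu := by
    change innerX u u = 0 at hu
    unfold innerX at hu
    rw [integral_eq_zero_iff_of_nonneg (fun p => by
      rw [gagliardoIntegrand_eq]; exact mul_self_nonneg _) (X.integrable_gagliardo u u)] at hu
    have h0 : ∀ᵐ p : ℝ × ℝ, u p.1 = u p.2 := by
      filter_upwards [hu] with p hp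
      rw [gagliardoIntegrand_eq, Pi.zero_apply, mul_self_eq_zero] at hp
      unfold diffQuot at hp
      rcases div_eq_zero_iff.1 hp with h | h
      · exact sub_eq_zero.1 h
      · rw [abs_eq_zero, sub_eq_zero] at h; rw [h]
    have h1 : ∀ᵐ y : ℝ, ∀ᵐ x : ℝ, u y = u x := Measure.ae_ae_of_ae_prod h0
    have hv : ∀ᵐ x : ℝ, x ∉ Set.Ioo (0 : ℝ) 1 → u x = 0 := u.2.2
    obtain ⟨y, ⟨hy1, hy2⟩, hy3⟩ :
        ∃ y : ℝ, ((∀ᵐ x : ℝ, u y = u x) ∧ (y ∉ Set.Ioo (0 : ℝ) 1 → u y = 0)) ∧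
          y ∈ Set.Ioo (2 : ℝ) 3 := by
      have hpos : (volume : Measure ℝ) (Set.Ioo (2 : ℝ) 3) ≠ 0 := by
        simp [Real.volume_Ioo]; norm_num
      exact ((h1.and hv).and_frequently (frequently_ae_mem_iff.2 hpos)).exists
    have hy0 : u y = 0 := hy2 fun h => by linarith [h.2, hy3.1]
    have hz : X.toL2 u = 0 := by
      refine Lp.ext ?_
      filter_upwards [hy1, Lp.coeFn_zero ℝ 2 (volume : Measure ℝ)] with x hx hx0
      rw [hx0, Pi.zero_apply, ← hx, hy0]
    exact Subtype.ext hz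

instance : NormedAddCommGroup X := coreX.toNormedAddCommGroup

instance : InnerProductSpace ℝ X := InnerProductSpace.ofCore coreX.toCore

/-- The norm of `X` is the Gagliardo seminorm of `H^{1/2}(ℝ)`. -/
lemma X.norm_eq (u : X) :
    ‖u‖ = √(∫ p : ℝ × ℝ, (u p.1 - u p.2) ^ 2 / |p.1 - p.2| ^ 2) := by
  have h : ‖u‖ = √(innerX u u) := rfl
  rw [h]; unfold innerX gagliardoIntegrand
  simp only [sq]

/-- The norm of `(-Δ)^{1/4} u` in `L²(ℝ)`, with values in `[0,∞]`. The operator `(-Δ)^{1/4}` is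
the Fourier multiplier with symbol `|2πξ|^{1/2}`, for the normalization
`û(ξ) = ∫ exp(-2πi x ξ) u(x) dx`, and the norm is read off on the Fourier side by Plancherel. -/
def quarterLapNorm (u : L2R) : ℝ≥0∞ :=
  eLpNorm (fun ξ : ℝ => ((√|2 * Real.pi * ξ| : ℝ) : ℂ) *
    (𝓕 (Complex.ofRealCLM.compLp u) : Lp ℂ 2 (volume : Measure ℝ)) ξ) 2 volume

/-- The Trudinger–Moser property of a number `w` in `(0,π]`: for every `0 < α < w` there is
`H > 0` such that the integral over `ℝ` of `exp(α u²) - 1` is at most `H ‖u‖²_{L²(ℝ)}` for all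
`u ∈ H^{1/2}(ℝ)` with `‖(-Δ)^{1/4} u‖_{L²(ℝ)} ≤ 1`. -/
def TrudingerMoser (w : ℝ) : Prop :=
  0 < w ∧ w ≤ Real.pi ∧ ∀ α : ℝ, 0 < α → α < w → ∃ H : ℝ, 0 < H ∧
    ∀ u : L2R, MemHHalf u → quarterLapNorm u ≤ 1 →
      ∫⁻ x : ℝ, ENNReal.ofReal (Real.exp (α * u x ^ 2) - 1) ≤ ENNReal.ofReal (H * ‖u‖ ^ 2)

/-- The optimal constant `ω ∈ (0,π]` of the Trudinger–Moser inequality on `H^{1/2}(ℝ)`. -/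
def omega : ℝ := sSup {w : ℝ | TrudingerMoser w}

/-- `λ₁`, the infimum of `‖u‖_X²` over all `u ∈ X` with `‖u‖_{L²(0,1)} = 1`. -/
def lambdaOne : ℝ :=
  sInf {r : ℝ | ∃ u : X, (∫ x in Set.Ioo (0 : ℝ) 1, u x ^ 2) = 1 ∧ r = ‖u‖ ^ 2}

/-- The primitive `F(t) = ∫₀ᵗ f(τ) dτ`. -/
def primitive (f : ℝ → ℝ) (t : ℝ) : ℝ := ∫ τ in (0 : ℝ)..t, f τ

/-- The functional `φ(u) = ‖u‖_X² / (4π) - ∫₀¹ F(u) dx` on `X`. -/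
def energy (f : ℝ → ℝ) (u : X) : ℝ :=
  ‖u‖ ^ 2 / (4 * Real.pi) - ∫ x in Set.Ioo (0 : ℝ) 1, primitive f (u x)

/-- The hypotheses on a nonlinearity `f` with critical exponential growth, of critical
exponent `α₀`. -/
structure CriticalHyp (f : ℝ → ℝ) (α₀ : ℝ) : Prop where
  continuous : Continuous f
  map_zero : f 0 = 0
  bound : ∃ t₀ M : ℝ, 0 < t₀ ∧ 0 < M ∧
    ∀ t : ℝ, t₀ ≤ |t| → 0 < primitive f t ∧ primitive f t ≤ M * |f t|
  superquadratic : ∀ t : ℝ, t ≠ 0 → 0 < 2 * primitive f t ∧ 2 * primitive f t ≤ f t * t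
  /-- The upper limit is taken in the extended reals. -/
  near_zero : limsup (fun t : ℝ => ((primitive f t / t ^ 2 : ℝ) : EReal)) (𝓝[≠] 0) <
    ((lambdaOne / (4 * Real.pi) : ℝ) : EReal)
  exponent_pos : 0 < α₀
  exponent_lt : α₀ < 2 * Real.pi * omega
  growth_below : ∀ α : ℝ, 0 < α → α < α₀ →
    Tendsto (fun t : ℝ => |f t| / Real.exp (α * t ^ 2)) (comap (fun t : ℝ => |t|) atTop) atTop
  growth_above : ∀ α : ℝ, α₀ < α →
    Tendsto (fun t : ℝ => |f t| / Real.exp (α * t ^ 2)) (comap (fun t : ℝ => |t|) atTop) (𝓝 0)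
  /-- The supremum is taken in the extended reals. -/
  level : ∃ ψ : X, ‖ψ‖ = 1 ∧
    (⨆ t : {t : ℝ // 0 < t}, ((t.1 ^ 2 / (4 * Real.pi) -
      ∫ x in Set.Ioo (0 : ℝ) 1, primitive f (t.1 * ψ x) : ℝ) : EReal)) <
    ((omega / (2 * α₀) : ℝ) : EReal)

/-- The Palais–Smale condition at level `c`: every sequence with `J(u_n) → c` and `J'(u_n) → 0`
in the dual space has a convergent subsequence. -/
def PalaisSmaleAt {E : Type*} [NormedAddCommGroup E] [NormedSpace ℝ E] (J : E → ℝ) (c : ℝ) :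
    Prop :=
  ∀ u : ℕ → E, Tendsto (fun n => J (u n)) atTop (𝓝 c) →
    Tendsto (fun n => fderiv ℝ J (u n)) atTop (𝓝 0) →
    ∃ (v : E) (k : ℕ → ℕ), StrictMono k ∧ Tendsto (fun n => u (k n)) atTop (𝓝 v)

end HalfLap

end

namespace HalfLap

/-! On `X` the Gagliardo norm satisfies `‖u‖² = 2π ‖(-Δ)^{1/4} u‖²` (`X.quarterLapNorm_sq`). Hence
the Trudinger–Moser inequality bounds `∫ exp(A w²)` uniformly over `‖w‖² ≤ 2πρ` whenever `Aρ < ω`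
(`exists_lintegral_exp_le`). Since bounded functions are dense in `X`, `exp(B u²)` is integrable for
each fixed `u` and every `B`, and this makes `φ` differentiable.

Hypothesis (i) gives `F(t) ≤ C_ε + ε f(t)t` for every `ε > 0`, so a Palais–Smale sequence `u_n` is
bounded and so is `∫ f(u_n)u_n`. By compactness of `X` in `L²`, a subsequence converges a.e. and
weakly in `X` to some `v`. A Vitali argument gives `∫ F(u_n) → ∫ F(v)` and `f(u_n) → f(v)` in `L¹`.
Therefore `‖u_n - v‖² → 4π(c - φ(v))`, and `v` is critical along its truncations, so that `φ'(v)v =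
0` and (ii) yields `φ(v) ≥ 0`.

The limit is thus at most `4πc < 2πω/α₀`: the differences `u_n - v` end up in a ball where the
Trudinger–Moser inequality holds with an exponent above `α₀`. This forces `∫ f(u_n)(u_n - v) → 0`
(`CriticalHyp.tendsto_integral_mul_sub`). Testing `φ'(u_n)` with `u_n - v` then gives `⟨u_n, u_n -
v⟩ → 0`, which together with weak convergence is convergence in norm. -/

/-! ### Plancherel and the Gagliardo seminorm on the Fourier side -/

open Complex in
/-- The Fourier transform on `L²` is given by the Fourier integral on `L¹ ∩ L²`. -/
lemma fourier_toLp_ae_eq {f : ℝ → ℂ} (h1 : Integrable f) (h2 : MemLp f 2 volume) :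
    ((𝓕 (h2.toLp f) : Lp ℂ 2 (volume : Measure ℝ)) : ℝ → ℂ) =ᵐ[volume] 𝓕 f := by
  have hcont : Continuous (𝓕 f) :=
    VectorFourier.fourierIntegral_continuous Real.continuous_fourierChar
      (by exact continuous_inner) h1
  -- Both sides are locally integrable, so test functions decide. The `L²` transform agrees with the
  -- distributional one, and the multiplication formula moves the transform from the test function
  -- to `f`.
  refine ae_eq_of_integral_contDiff_smul_eq
    ((Lp.memLp _).locallyIntegrable (by norm_num)) hcont.locallyIntegrable ?_
  intro g hg hgc
  have hg₁ : HasCompactSupport (Complex.ofRealCLM ∘ g) := hgc.comp_left rfl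
  have hg₂ : ContDiff ℝ ((⊤ : ℕ∞) : WithTop ℕ∞) (Complex.ofRealCLM ∘ g) :=
    Complex.ofRealCLM.contDiff.comp hg
  set φ := hg₁.toSchwartzMap hg₂ with hφ
  have hφg : ∀ x, φ x = (g x : ℂ) := fun x => by simp [hφ]
  have e1 := congrArg (fun T => T φ) (Lp.fourier_toTemperedDistribution_eq (h2.toLp f))
  simp only [TemperedDistribution.fourier_apply, Lp.toTemperedDistribution_apply] at e1
  have e2 : ∫ x, (𝓕 φ) x • (h2.toLp f) x = ∫ x, (𝓕 φ) x • f x := by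
    refine integral_congr_ae ?_
    filter_upwards [h2.coeFn_toLp] with x hx
    rw [hx]
  have e3 : ∫ x, (𝓕 (φ : ℝ → ℂ)) x • f x = ∫ x, φ x • (𝓕 f) x :=
by
    have := VectorFourier.integral_fourierIntegral_smul_eq_flip (μ := volume) (ν := volume)
      (L := innerₗ ℝ) Real.continuous_fourierChar (by exact continuous_inner)
      (φ.integrable (μ := volume)) h1
    rwa [flip_innerₗ] at this
  rw [e2] at e1
  simp only [SchwartzMap.fourier_coe, e3, hφg] at e1
  simpa using e1.symm

lemma lintegral_enorm_fourier_sq {f : ℝ → ℂ} (h1 : Integrable f) (h2 : MemLp f 2 volume) :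
    ∫⁻ ξ, ‖𝓕 f ξ‖ₑ ^ 2 = ∫⁻ x, ‖f x‖ₑ ^ 2 := by
  have key : eLpNorm (𝓕 f) 2 volume = eLpNorm f 2 volume := by
    rw [← eLpNorm_congr_ae (fourier_toLp_ae_eq h1 h2), ← eLpNorm_congr_ae h2.coeFn_toLp,
      ← Lp.enorm_def, ← Lp.enorm_def, ← ofReal_norm, ← ofReal_norm, Lp.norm_fourier_eq]
  have h := congrArg (fun t : ℝ≥0∞ => t ^ (2 : ℝ)) key
  simp only [eLpNorm_eq_lintegral_rpow_enorm_toReal (two_ne_zero) (ENNReal.ofNat_ne_top),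
    ENNReal.toReal_ofNat, one_div, ← ENNReal.rpow_mul] at h
  simpa using h

lemma fourier_comp_add (f : ℝ → ℂ) (h ξ : ℝ) :
    𝓕 (fun x => f (x + h)) ξ = (Real.fourierChar (h * ξ) : ℂ) * 𝓕 f ξ := by
  have := congrFun (VectorFourier.fourierIntegral_comp_add_right Real.fourierChar volume
    (innerₗ ℝ) f h) ξ
  simp only [Function.comp_def] at this
  change VectorFourier.fourierIntegral Real.fourierChar volume (innerₗ ℝ) _ ξ = _
  rw [this, Circle.smul_def, smul_eq_mul, innerₗ_apply_apply, real_inner_comm, RCLike.inner_apply,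
    conj_trivial]
  rfl

lemma lintegral_translate_sub_sq {f : ℝ → ℂ} (h1 : Integrable f) (h2 : MemLp f 2 volume)
    (h : ℝ) :
    ∫⁻ x, ‖f (x + h) - f x‖ₑ ^ 2 =
      ∫⁻ ξ, ‖(Real.fourierChar (h * ξ) : ℂ) - 1‖ₑ ^ 2 * ‖𝓕 f ξ‖ₑ ^ 2 := by
  have i1 : Integrable (fun x => f (x + h)) := h1.comp_add_right h
  have i2 : MemLp (fun x => f (x + h)) 2 volume :=
    h2.comp_measurePreserving (measurePreserving_add_right volume h)
  rw [← lintegral_enorm_fourier_sq (f := fun x => f (x + h) - f x) (i1.sub h1) (i2.sub h2)]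
  refine lintegral_congr fun ξ => ?_
  have : 𝓕 (fun x => f (x + h) - f x) ξ = 𝓕 (fun x => f (x + h)) ξ - 𝓕 f ξ := by
    simp only [Real.fourier_eq, smul_sub]
    exact integral_sub ((Real.fourierIntegral_convergent_iff _).2 i1)
      ((Real.fourierIntegral_convergent_iff _).2 h1)
  rw [this, fourier_comp_add, ← sub_one_mul, enorm_mul, mul_pow]

lemma fourier_indicator_unitInterval {ξ : ℝ} (hξ : ξ ≠ 0) :
    𝓕 (Set.indicator (Set.Ioc (0 : ℝ) 1) (fun _ => (1 : ℂ))) ξ =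
      ((Real.fourierChar (-ξ) : ℂ) - 1) / (-(2 * Real.pi * ξ) * Complex.I) := by
  rw [Real.fourier_real_eq_integral_exp_smul]
  have hc : -(2 * Real.pi * ξ) * Complex.I ≠ 0 := by
    have : (Real.pi : ℂ) ≠ 0 := by exact_mod_cast Real.pi_ne_zero
    have : (ξ : ℂ) ≠ 0 := by exact_mod_cast hξ
    simp [*]
  have : (fun v : ℝ => Complex.exp (↑(-2 * Real.pi * v * ξ) * Complex.I) •
      Set.indicator (Set.Ioc (0 : ℝ) 1) (fun _ => (1 : ℂ)) v) =
      Set.indicator (Set.Ioc (0 : ℝ) 1)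
        (fun v : ℝ => Complex.exp (-(2 * Real.pi * ξ) * Complex.I * v)) := by
    funext v
    by_cases hv : v ∈ Set.Ioc (0 : ℝ) 1
    · simp only [Set.indicator_of_mem hv, smul_eq_mul, mul_one]
      congr 1; push_cast; ring
    · simp [Set.indicator_of_notMem hv]
  rw [this, integral_indicator measurableSet_Ioc, ← intervalIntegral.integral_of_le zero_le_one,
    integral_exp_mul_complex hc]
  simp only [Complex.ofReal_one, mul_one, Complex.ofReal_zero, mul_zero, Complex.exp_zero,
    Real.fourierChar_apply]
  congr 3; push_cast; ring

/-- Plancherel for the indicator of `(0,1]`, whose transform has modulus `|e(-ξ) - 1| / (2π|ξ|)` and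
whose `L²` norm is `1`. -/
lemma lintegral_fourierChar_sub_one :
    ∫⁻ h : ℝ, ‖(Real.fourierChar h : ℂ) - 1‖ₑ ^ 2 / ‖h‖ₑ ^ 2 =
      ENNReal.ofReal (2 * Real.pi) ^ 2 := by
  set g : ℝ → ℂ := Set.indicator (Set.Ioc (0 : ℝ) 1) (fun _ => (1 : ℂ)) with hg
  have h2 : MemLp g 2 volume := memLp_indicator_const 2 measurableSet_Ioc 1 (by simp)
  have h1 : Integrable g :=
    memLp_one_iff_integrable.1 (memLp_indicator_const 1 measurableSet_Ioc 1 (by simp))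
  have e := lintegral_enorm_fourier_sq h1 h2
  have er : ∫⁻ x, ‖g x‖ₑ ^ 2 = 1 := by
    have : (fun x => ‖g x‖ₑ ^ 2) = Set.indicator (Set.Ioc (0 : ℝ) 1) (fun _ => (1 : ℝ≥0∞)) := by
      funext x
      by_cases hx : x ∈ Set.Ioc (0 : ℝ) 1
      · simp [hg, Set.indicator_of_mem hx]
      · simp [hg, Set.indicator_of_notMem hx]
    rw [this, lintegral_indicator measurableSet_Ioc]; simp
  have el : ∫⁻ ξ, ‖𝓕 g ξ‖ₑ ^ 2 = (ENNReal.ofReal (2 * Real.pi) ^ 2)⁻¹ *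
      ∫⁻ h : ℝ, ‖(Real.fourierChar (-h) : ℂ) - 1‖ₑ ^ 2 / ‖h‖ₑ ^ 2 := by
    rw [← lintegral_const_mul _ (by fun_prop)]
    refine lintegral_congr_ae ?_
    filter_upwards [Measure.ae_ne volume (0 : ℝ)] with ξ hξ
    rw [fourier_indicator_unitInterval hξ, div_eq_mul_inv, enorm_mul, enorm_inv, enorm_mul,
      enorm_neg, enorm_mul, mul_pow]
    · have hr : ∀ x : ℝ, ‖(x : ℂ)‖ₑ = ‖x‖ₑ := fun x => by
        rw [← ofReal_norm, ← ofReal_norm, Complex.norm_real]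
      have hI : ‖Complex.I‖ₑ = 1 := by rw [← ofReal_norm, Complex.norm_I, ENNReal.ofReal_one]
      have : ‖(2 : ℂ)‖ₑ * ‖(Real.pi)‖ₑ = ENNReal.ofReal (2 * Real.pi) := by
        rw [← ofReal_norm, ← ofReal_norm, ← ENNReal.ofReal_mul (by positivity)]
        simp [abs_of_pos Real.pi_pos]
      rw [enorm_mul, hr, hr, hI, mul_one, this, ENNReal.mul_inv (by left; simp [Real.pi_pos])
        (by left; exact ENNReal.ofReal_ne_top), mul_pow]
      simp only [div_eq_mul_inv, ENNReal.inv_pow]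
      ring
    · have : (Real.pi : ℂ) ≠ 0 := by exact_mod_cast Real.pi_ne_zero
      have : (ξ : ℂ) ≠ 0 := by exact_mod_cast hξ
      simp [*]
  rw [el, er] at e
  have en : ∫⁻ h : ℝ, ‖(Real.fourierChar (-h) : ℂ) - 1‖ₑ ^ 2 / ‖h‖ₑ ^ 2 =
      ∫⁻ h : ℝ, ‖(Real.fourierChar h : ℂ) - 1‖ₑ ^ 2 / ‖h‖ₑ ^ 2 := by
    rw [← lintegral_neg_eq_self (fun h : ℝ => ‖(Real.fourierChar h : ℂ) - 1‖ₑ ^ 2 / ‖h‖ₑ ^ 2)]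
    simp
  rw [en] at e
  have hp0 : ENNReal.ofReal (2 * Real.pi) ^ 2 ≠ 0 := by simp [Real.pi_pos]
  have hpt : ENNReal.ofReal (2 * Real.pi) ^ 2 ≠ ⊤ := ENNReal.pow_ne_top ENNReal.ofReal_ne_top
  rw [← one_mul (∫⁻ h : ℝ, _), ← ENNReal.mul_inv_cancel hp0 hpt, mul_assoc, e, mul_one]

/-- The scaling `h ↦ hξ` reduces this to `ξ = 1`; it is where the symbol `|2πξ|` comes from. -/
lemma lintegral_fourierChar_mul_sub_one (ξ : ℝ) :
    ∫⁻ h : ℝ, ‖(Real.fourierChar (h * ξ) : ℂ) - 1‖ₑ ^ 2 / ‖h‖ₑ ^ 2 =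
      ENNReal.ofReal (2 * Real.pi) * ENNReal.ofReal |2 * Real.pi * ξ| := by
  rcases eq_or_ne ξ 0 with rfl | hξ
  · simp
  have h1 := lintegral_fourierChar_sub_one
  rw [← Real.smul_map_volume_mul_right hξ, lintegral_smul_measure, lintegral_map (by fun_prop)
    (by fun_prop)] at h1
  have hx0 : ‖ξ‖ₑ ≠ 0 := by simpa using hξ
  have e : ∫⁻ h : ℝ, ‖(Real.fourierChar (h * ξ) : ℂ) - 1‖ₑ ^ 2 / ‖h * ξ‖ₑ ^ 2 =
      (‖ξ‖ₑ ^ 2)⁻¹ * ∫⁻ h : ℝ, ‖(Real.fourierChar (h * ξ) : ℂ) - 1‖ₑ ^ 2 / ‖h‖ₑ ^ 2 := by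
    rw [← lintegral_const_mul _ (by fun_prop)]
    refine lintegral_congr fun h => ?_
    rw [enorm_mul, mul_pow, div_eq_mul_inv, ENNReal.mul_inv (by right; simp) (by right; simp [hξ]),
      div_eq_mul_inv]
    ring
  have habs : ENNReal.ofReal |ξ| = ‖ξ‖ₑ := (Real.enorm_eq_ofReal_abs ξ).symm
  rw [e, habs, smul_eq_mul, ← mul_assoc] at h1
  have h3 : ‖ξ‖ₑ * (‖ξ‖ₑ ^ 2)⁻¹ = ‖ξ‖ₑ⁻¹ := by
    rw [sq, ENNReal.mul_inv (by left; exact hx0) (by left; simp), ← mul_assoc,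
      ENNReal.mul_inv_cancel hx0 (by simp), one_mul]
  rw [h3] at h1
  rw [abs_mul, ENNReal.ofReal_mul (abs_nonneg _), habs, abs_of_pos Real.two_pi_pos, ← mul_assoc,
    ← sq, ← h1, mul_comm, ← mul_assoc, ENNReal.mul_inv_cancel hx0 (by simp), one_mul]

/-- The Gagliardo seminorm on the Fourier side. -/
lemma lintegral_gagliardo_eq {f : ℝ → ℂ} (hm : Measurable f) (h1 : Integrable f)
    (h2 : MemLp f 2 volume) :
    ∫⁻ p : ℝ × ℝ, ‖f p.1 - f p.2‖ₑ ^ 2 / ‖p.1 - p.2‖ₑ ^ 2 =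
      ENNReal.ofReal (2 * Real.pi) *
        ∫⁻ ξ, ENNReal.ofReal |2 * Real.pi * ξ| * ‖𝓕 f ξ‖ₑ ^ 2 := by
  have hF : Measurable (𝓕 f) :=
    (VectorFourier.fourierIntegral_continuous Real.continuous_fourierChar
      (by exact continuous_inner) h1).measurable
  rw [Measure.volume_eq_prod, lintegral_prod_symm' _ (by fun_prop)]
  -- Put `x = y + h`, apply Plancherel in `y` for fixed `h`, and integrate over `h` first by
  -- Tonelli.
  calc ∫⁻ y, ∫⁻ x, ‖f x - f y‖ₑ ^ 2 / ‖x - y‖ₑ ^ 2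
      = ∫⁻ y, ∫⁻ h, ‖f (y + h) - f y‖ₑ ^ 2 / ‖h‖ₑ ^ 2 := by
        refine lintegral_congr fun y => ?_
        rw [← lintegral_add_left_eq_self _ y]
        simp
    _ = ∫⁻ h, ∫⁻ y, ‖f (y + h) - f y‖ₑ ^ 2 / ‖h‖ₑ ^ 2 :=
        lintegral_lintegral_swap (by fun_prop)
    _ = ∫⁻ h : ℝ, ∫⁻ ξ, ‖(Real.fourierChar (h * ξ) : ℂ) - 1‖ₑ ^ 2 / ‖h‖ₑ ^ 2 * ‖𝓕 f ξ‖ₑ ^ 2 := by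
        refine lintegral_congr fun h => ?_
        simp only [div_eq_mul_inv]
        rw [lintegral_mul_const _ (by fun_prop), lintegral_translate_sub_sq h1 h2,
          ← lintegral_mul_const _ (by fun_prop)]
        refine lintegral_congr fun ξ => ?_
        ring
    _ = ∫⁻ ξ : ℝ, ∫⁻ h, ‖(Real.fourierChar (h * ξ) : ℂ) - 1‖ₑ ^ 2 / ‖h‖ₑ ^ 2 * ‖𝓕 f ξ‖ₑ ^ 2 :=
        lintegral_lintegral_swap (by fun_prop)
    _ = _ := by
        rw [← lintegral_const_mul _ (by fun_prop)]
        refine lintegral_congr fun ξ => ?_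
        rw [lintegral_mul_const _ (by fun_prop), lintegral_fourierChar_mul_sub_one, mul_assoc]

/-! ### The norm of `X`: link with the quarter Laplacian, Poincaré inequality -/

lemma X.ae_eq_zero (u : X) : ∀ᵐ x : ℝ, x ∉ Set.Ioo (0 : ℝ) 1 → u x = 0 := u.2.2

lemma X.norm_sq (u : X) : ‖u‖ ^ 2 = ∫ p : ℝ × ℝ, diffQuot u p ^ 2 := by
  rw [X.norm_eq, Real.sq_sqrt (integral_nonneg fun p => by positivity)]
  simp only [diffQuot, div_pow]

lemma X.lintegral_diffQuot (u : X) :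
    ∫⁻ p : ℝ × ℝ, ENNReal.ofReal (diffQuot u p ^ 2) = ENNReal.ofReal (‖u‖ ^ 2) := by
  rw [X.norm_sq, ofReal_integral_eq_lintegral_ofReal]
  · exact (memLp_two_iff_integrable_sq (diffQuot_aesm _)).1 (X.memLp_diffQuot u)
  · exact Eventually.of_forall fun p => sq_nonneg _

lemma X.measurable (u : X) : Measurable u := (Lp.stronglyMeasurable (X.toL2 u)).measurable

lemma X.integrable (u : X) : Integrable u := by
  have h2 : MemLp u 2 volume := Lp.memLp (X.toL2 u)
  have h3 : IntegrableOn u (Set.Ioo (0 : ℝ) 1) := by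
    refine memLp_one_iff_integrable.1 ?_
    exact (h2.restrict _).mono_exponent (by norm_num)
  exact h3.integrable_of_ae_notMem_eq_zero u.ae_eq_zero

/-- On `X`, the Gagliardo norm is `√(2π)` times the `L²`-norm of `(-Δ)^{1/4}`. -/
lemma X.quarterLapNorm_sq (u : X) :
    ENNReal.ofReal (2 * Real.pi) * quarterLapNorm (X.toL2 u) ^ 2 = ENNReal.ofReal (‖u‖ ^ 2) := by
  set f : ℝ → ℂ := fun x => (u x : ℂ) with hf
  have hm : Measurable f := Complex.measurable_ofReal.comp u.measurable
  have h1 : Integrable f := u.integrable.ofReal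
  have h2 : MemLp f 2 volume := MemLp.ofReal (Lp.memLp (X.toL2 u))
  have hT : Complex.ofRealCLM.compLp (X.toL2 u) = h2.toLp f := by
    refine Lp.ext ?_
    filter_upwards [h2.coeFn_toLp, Complex.ofRealCLM.coeFn_compLp (X.toL2 u)] with x ha hb
    rw [ha, hb]; rfl
  have hq : quarterLapNorm (X.toL2 u) ^ 2 =
      ∫⁻ ξ, ENNReal.ofReal |2 * Real.pi * ξ| * ‖𝓕 f ξ‖ₑ ^ 2 := by
    unfold quarterLapNorm
    rw [hT, eLpNorm_eq_lintegral_rpow_enorm_toReal two_ne_zero ENNReal.ofNat_ne_top,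
      ENNReal.toReal_ofNat, one_div, ← ENNReal.rpow_natCast, ← ENNReal.rpow_mul, Nat.cast_ofNat,
      inv_mul_cancel₀ two_ne_zero, ENNReal.rpow_one]
    simp only [ENNReal.rpow_ofNat]
    refine lintegral_congr_ae ?_
    filter_upwards [fourier_toLp_ae_eq h1 h2] with ξ hξ
    rw [hξ, enorm_mul, mul_pow, ← ofReal_norm, Complex.norm_real,
      ← ENNReal.ofReal_pow (norm_nonneg _), Real.norm_eq_abs, sq_abs, Real.sq_sqrt (abs_nonneg _)]
  rw [hq, ← lintegral_gagliardo_eq hm h1 h2, ← X.lintegral_diffQuot]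
  refine lintegral_congr fun p => ?_
  -- On the diagonal both quotients are `0 / 0`, which is `0` in `ℝ` and in `ℝ≥0∞`.
  rcases eq_or_ne p.1 p.2 with hp | hp
  · simp [diffQuot, hp]
  have hp' : 0 < |p.1 - p.2| := abs_pos.2 (sub_ne_zero.2 hp)
  have e1 : f p.1 - f p.2 = ((u p.1 - u p.2 : ℝ) : ℂ) := by simp [hf]
  rw [e1, diffQuot, div_pow, ENNReal.ofReal_div_of_pos (by positivity), ← ofReal_norm,
    Complex.norm_real, ← ofReal_norm, ENNReal.ofReal_pow (abs_nonneg _), ← sq_abs,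
    ENNReal.ofReal_pow (abs_nonneg _)]
  rfl

lemma ofReal_norm_sq_eq_lintegral {α : Type*} [MeasurableSpace α] {μ : Measure α}
    (g : Lp ℝ 2 μ) :
    ENNReal.ofReal (‖g‖ ^ 2) = ∫⁻ x, ENNReal.ofReal (g x ^ 2) ∂μ := by
  rw [ENNReal.ofReal_pow (norm_nonneg _), ofReal_norm, Lp.enorm_def,
    eLpNorm_eq_lintegral_rpow_enorm_toReal two_ne_zero ENNReal.ofNat_ne_top,
    ENNReal.toReal_ofNat, one_div, ← ENNReal.rpow_natCast, ← ENNReal.rpow_mul, Nat.cast_ofNat,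
    inv_mul_cancel₀ two_ne_zero, ENNReal.rpow_one]
  refine lintegral_congr fun x => ?_
  rw [ENNReal.rpow_ofNat, ← ofReal_norm, ← ENNReal.ofReal_pow (norm_nonneg _), Real.norm_eq_abs,
    sq_abs]

lemma measurable_diffQuot {u : ℝ → ℝ} (hu : Measurable u) : Measurable (diffQuot u) := by
  unfold diffQuot; fun_prop

lemma X.inner_eq (u v : X) : inner ℝ u v = ∫ p : ℝ × ℝ, diffQuot u p * diffQuot v p := by
  have : inner ℝ u v = innerX u v := rfl
  rw [this, innerX]
  simp only [gagliardoIntegrand_eq]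

lemma X.lintegral_sq_eq_setLIntegral (u : X) :
    ∫⁻ x, ENNReal.ofReal (u x ^ 2) = ∫⁻ x in Set.Ioo (0 : ℝ) 1, ENNReal.ofReal (u x ^ 2) := by
  rw [← lintegral_indicator measurableSet_Ioo]
  refine lintegral_congr_ae ?_
  filter_upwards [u.ae_eq_zero] with x hx
  by_cases h : x ∈ Set.Ioo (0 : ℝ) 1
  · simp [h]
  · simp [h, hx h]

/-- The Poincaré inequality on `X`. -/
lemma X.norm_toL2_le (u : X) : ‖X.toL2 u‖ ≤ 3 * ‖u‖ := by
  have key : ENNReal.ofReal (‖X.toL2 u‖ ^ 2) ≤ ENNReal.ofReal ((3 * ‖u‖) ^ 2) := by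
    rw [ofReal_norm_sq_eq_lintegral, u.lintegral_sq_eq_setLIntegral, mul_pow,
      ENNReal.ofReal_mul (by positivity), ← u.lintegral_diffQuot]
    have hm := u.measurable
    have hD : Measurable (diffQuot u) := measurable_diffQuot hm
    -- Compare with points `y ∈ (2,3)`, where `u` vanishes: there `u(x)² = (u(x) - u(y))²` and `|x -
    -- y| ≤ 3`.
    calc ∫⁻ x in Set.Ioo (0 : ℝ) 1, ENNReal.ofReal (u x ^ 2)
        = ∫⁻ x in Set.Ioo (0 : ℝ) 1, ∫⁻ y in Set.Ioo (2 : ℝ) 3, ENNReal.ofReal (u x ^ 2) := by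
          refine lintegral_congr fun x => ?_
          rw [setLIntegral_const, Real.volume_Ioo]
          norm_num
      _ ≤ ∫⁻ x in Set.Ioo (0 : ℝ) 1, ∫⁻ y in Set.Ioo (2 : ℝ) 3,
            ENNReal.ofReal (3 ^ 2) * ENNReal.ofReal (diffQuot u (x, y) ^ 2) := by
          refine setLIntegral_mono' measurableSet_Ioo fun x hx => ?_
          refine setLIntegral_mono_ae' measurableSet_Ioo ?_
          filter_upwards [u.ae_eq_zero] with y hy hy'
          have hy0 : u y = 0 := hy fun h => by linarith [h.2, hy'.1]
          rw [← ENNReal.ofReal_mul (by positivity)]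
          refine ENNReal.ofReal_le_ofReal ?_
          have h1 : 0 < |x - y| := abs_pos.2 (by linarith [hx.2, hy'.1])
          have h2 : |x - y| ≤ 3 := abs_le.2 ⟨by linarith [hx.1, hy'.2], by linarith [hx.2, hy'.1]⟩
          simp only [diffQuot, hy0, sub_zero, div_pow]
          rw [← mul_div_assoc, le_div_iff₀ (by positivity), mul_comm]
          exact mul_le_mul_of_nonneg_right (by gcongr) (sq_nonneg _)
      _ = ∫⁻ p in Set.Ioo (0 : ℝ) 1 ×ˢ Set.Ioo (2 : ℝ) 3,
            ENNReal.ofReal (3 ^ 2) * ENNReal.ofReal (diffQuot u p ^ 2) := by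
          rw [Measure.volume_eq_prod, setLIntegral_prod _ (by fun_prop)]
      _ ≤ ∫⁻ p, ENNReal.ofReal (3 ^ 2) * ENNReal.ofReal (diffQuot u p ^ 2) :=
          setLIntegral_le_lintegral _ _
      _ = _ := lintegral_const_mul _ (by fun_prop)
  rw [ENNReal.ofReal_le_ofReal_iff (by positivity)] at key
  exact (pow_le_pow_iff_left₀ (norm_nonneg _) (by positivity) two_ne_zero).1 key

/-- The embedding of `X` into `L²(ℝ)`. -/
noncomputable def X.toL2CLM : X →L[ℝ] L2R := X.toL2.mkContinuous 3 X.norm_toL2_le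

@[simp] lemma X.toL2CLM_apply (u : X) : X.toL2CLM u = X.toL2 u := rfl

/-! ### Compactness of the embedding into `L²` -/

/-- The distance of a function to its mean on an interval. -/
lemma lintegral_sub_mean_le {u : ℝ → ℝ} (hm : Measurable u) (h2 : MemLp u 2 volume) {a ℓ : ℝ}
    (hℓ : 0 < ℓ) :
    ∫⁻ x in Set.Ico a (a + ℓ), ENNReal.ofReal ((u x - ℓ⁻¹ * ∫ y in Set.Ico a (a + ℓ), u y) ^ 2) ≤
      ENNReal.ofReal ℓ * ∫⁻ p in Set.Ico a (a + ℓ) ×ˢ Set.Ico a (a + ℓ),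
        ENNReal.ofReal (diffQuot u p ^ 2) := by
  set I := Set.Ico a (a + ℓ) with hI
  set m := ℓ⁻¹ * ∫ y in I, u y with hmdef
  have hvol : volume.real I = ℓ := by simp [hI, measureReal_def, Real.volume_Ico, hℓ.le]
  have hfin : IsFiniteMeasure (volume.restrict I) := ⟨by simp [hI]⟩
  have hu2 : MemLp u 2 (volume.restrict I) := h2.restrict I
  have hu1 : Integrable u (volume.restrict I) := hu2.integrable (by norm_num)
  have hD : Measurable (diffQuot u) := measurable_diffQuot hm
  -- By the variance identity `∫ (c - u)² = ℓ(c - m)² + ∫ (m - u)²`.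
  have jensen : ∀ c : ℝ, ENNReal.ofReal ((c - m) ^ 2) ≤
      ENNReal.ofReal ℓ⁻¹ * ∫⁻ y in I, ENNReal.ofReal ((c - u y) ^ 2) := by
    intro c
    have i1 : Integrable (fun y => (c - u y) ^ 2) (volume.restrict I) :=
      ((memLp_const c).sub hu2).integrable_sq
    have i2 : Integrable (fun y => (m - u y) ^ 2) (volume.restrict I) :=
      ((memLp_const m).sub hu2).integrable_sq
    have i3 : Integrable (fun y => m - u y) (volume.restrict I) := (integrable_const m).sub hu1
    rw [← ofReal_integral_eq_lintegral_ofReal i1 (Eventually.of_forall fun _ => sq_nonneg _),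
      ← ENNReal.ofReal_mul (by positivity)]
    refine ENNReal.ofReal_le_ofReal ?_
    have e0 : ∫ y in I, (m - u y) = 0 := by
      rw [integral_sub (integrable_const m) hu1, setIntegral_const, hvol, hmdef]
      simp only [smul_eq_mul]
      field_simp
      ring
    have e1 : ∫ y in I, (c - u y) ^ 2 =
        ℓ * (c - m) ^ 2 + ∫ y in I, (m - u y) ^ 2 := by
      have : ∀ y, (c - u y) ^ 2 = (c - m) ^ 2 + (2 * (c - m) * (m - u y) + (m - u y) ^ 2) :=
        fun y => by ring
      simp only [this]
      rw [integral_add (integrable_const _) (by exact (i3.const_mul _).add i2),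
        integral_add (i3.const_mul _) i2, integral_const_mul, e0, setIntegral_const, hvol]
      simp
    rw [e1, mul_add, ← mul_assoc, inv_mul_cancel₀ hℓ.ne', one_mul]
    have : 0 ≤ ∫ y in I, (m - u y) ^ 2 := integral_nonneg fun _ => sq_nonneg _
    have : 0 ≤ ℓ⁻¹ * ∫ y in I, (m - u y) ^ 2 := by positivity
    linarith
  calc ∫⁻ x in I, ENNReal.ofReal ((u x - m) ^ 2)
      ≤ ∫⁻ x in I, ENNReal.ofReal ℓ⁻¹ * ∫⁻ y in I, ENNReal.ofReal ((u x - u y) ^ 2) :=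
        lintegral_mono fun x => jensen (u x)
    -- Here `|x - y| ≤ ℓ` on `I × I` costs a factor `ℓ²` against `ℓ⁻¹`.
    _ ≤ ∫⁻ x in I, ∫⁻ y in I, ENNReal.ofReal ℓ * ENNReal.ofReal (diffQuot u (x, y) ^ 2) := by
        refine setLIntegral_mono' measurableSet_Ico fun x hx => ?_
        rw [← lintegral_const_mul _ (by fun_prop)]
        refine setLIntegral_mono' measurableSet_Ico fun y hy => ?_
        rw [← ENNReal.ofReal_mul (by positivity), ← ENNReal.ofReal_mul (by positivity)]
        refine ENNReal.ofReal_le_ofReal ?_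
        rcases eq_or_ne x y with rfl | hxy
        · simp [diffQuot]
        have h1 : 0 < |x - y| := abs_pos.2 (sub_ne_zero.2 hxy)
        have h3 : |x - y| ≤ ℓ := abs_le.2 ⟨by linarith [hx.1, hy.2], by linarith [hx.2, hy.1]⟩
        simp only [diffQuot, div_pow]
        rw [inv_mul_le_iff₀ hℓ, ← mul_assoc, ← mul_div_assoc, le_div_iff₀ (by positivity), mul_comm]
        refine mul_le_mul_of_nonneg_right ?_ (sq_nonneg _)
        nlinarith
    _ = ∫⁻ p in I ×ˢ I, ENNReal.ofReal ℓ * ENNReal.ofReal (diffQuot u p ^ 2) := by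
        rw [Measure.volume_eq_prod, setLIntegral_prod _ (by fun_prop)]
    _ = _ := lintegral_const_mul _ (by fun_prop)

/-- The `i`-th cell of the uniform partition of `[0,1)` into `N + 1` intervals. -/
def cell (N i : ℕ) : Set ℝ := Set.Ico (i / (N + 1 : ℝ)) (i / (N + 1 : ℝ) + (N + 1 : ℝ)⁻¹)

lemma measurableSet_cell (N i : ℕ) : MeasurableSet (cell N i) := measurableSet_Ico

lemma mem_cell {N i : ℕ} {x : ℝ} : x ∈ cell N i ↔ (i : ℝ) ≤ (N + 1) * x ∧ (N + 1) * x < i + 1 := by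
  have h : (0 : ℝ) < N + 1 := by positivity
  rw [cell, Set.mem_Ico, div_le_iff₀ h, mul_comm x]
  refine and_congr_right fun _ => ?_
  rw [show (i : ℝ) / (N + 1) + (N + 1 : ℝ)⁻¹ = (i + 1) / (N + 1) by ring, lt_div_iff₀ h, mul_comm]

lemma cell_disjoint (N : ℕ) : Pairwise (Function.onFun Disjoint (cell N)) := by
  intro i j hij
  refine Set.disjoint_left.2 fun x hi hj => hij ?_
  rw [mem_cell] at hi hj
  have h1 : i < j + 1 := by exact_mod_cast hi.1.trans_lt hj.2
  have h2 : j < i + 1 := by exact_mod_cast hj.1.trans_lt hi.2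
  omega

lemma Ioo_subset_iUnion_cell (N : ℕ) :
    Set.Ioo (0 : ℝ) 1 ⊆ ⋃ i ∈ Finset.range (N + 1), cell N i := by
  intro x hx
  have h : (0 : ℝ) < N + 1 := by positivity
  have h0 : 0 ≤ (N + 1) * x := mul_nonneg h.le hx.1.le
  simp only [Set.mem_iUnion, Finset.mem_range]
  refine ⟨⌊(N + 1) * x⌋₊, ?_, mem_cell.2 ⟨Nat.floor_le h0, Nat.lt_floor_add_one _⟩⟩
  rw [Nat.floor_lt h0]
  push_cast
  nlinarith [hx.2]

/-- The indicator function of a cell in `L²(ℝ)`. -/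
noncomputable def cellFun (N i : ℕ) : L2R :=
  indicatorConstLp 2 (measurableSet_cell N i) (by simp [cell]) (1 : ℝ)

/-- Averaging over the cells of the uniform partition. -/
noncomputable def averaging (N : ℕ) : L2R →L[ℝ] L2R :=
  ∑ i ∈ Finset.range (N + 1),
    (innerSL ℝ (cellFun N i)).smulRight ((N + 1 : ℝ) • cellFun N i)

lemma isCompactOperator_smulRight {E F : Type*} [NormedAddCommGroup E] [NormedSpace ℝ E]
    [NormedAddCommGroup F] [NormedSpace ℝ F] (g : E →L[ℝ] ℝ) (v : F) :
    IsCompactOperator (g.smulRight v) := by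
  have h : IsCompactOperator (g : E → ℝ) := (isCompactOperator_id (E := ℝ)).comp_clm g
  exact h.clm_comp (ContinuousLinearMap.toSpanSingleton ℝ v)

lemma isCompactOperator_averaging (N : ℕ) : IsCompactOperator (averaging N) := by
  have : averaging N ∈ compactOperator (RingHom.id ℝ) L2R L2R :=
    Submodule.sum_mem _ fun i _ => isCompactOperator_smulRight _ _
  exact this

lemma averaging_ae_eq (N : ℕ) (u : L2R) :
    ∀ᵐ x : ℝ, averaging N u x = ∑ i ∈ Finset.range (N + 1),
      (cell N i).indicator (fun _ => (N + 1 : ℝ) * ∫ y in cell N i, u y) x := by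
  have h1 : averaging N u = ∑ i ∈ Finset.range (N + 1),
      (((N + 1 : ℝ) * ∫ y in cell N i, u y) • cellFun N i) := by
    simp only [averaging, _root_.sum_apply, ContinuousLinearMap.smulRight_apply,
      innerSL_apply_apply, smul_smul]
    refine Finset.sum_congr rfl fun i _ => ?_
    rw [cellFun, L2.inner_indicatorConstLp_one, mul_comm]
  have h2 : ∀ᵐ x : ℝ, ∀ i ∈ Finset.range (N + 1),
      (((N + 1 : ℝ) * ∫ y in cell N i, u y) • cellFun N i : L2R) x =
        (cell N i).indicator (fun _ => (N + 1 : ℝ) * ∫ y in cell N i, u y) x := by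
    refine (Finset.eventually_all _).2 fun i _ => ?_
    filter_upwards [Lp.coeFn_smul ((N + 1 : ℝ) * ∫ y in cell N i, u y) (cellFun N i),
      (show cellFun N i =ᵐ[volume] _ from indicatorConstLp_coeFn)] with x hx hx'
    rw [hx, Pi.smul_apply, show cellFun N i x = _ from hx']
    by_cases h : x ∈ cell N i <;> simp [h]
  filter_upwards [h2, Lp.coeFn_fun_finsetSum (Finset.range (N + 1))
    (fun i => (((N + 1 : ℝ) * ∫ y in cell N i, u y) • cellFun N i : L2R))] with x hx hx'
  rw [h1, hx']
  exact Finset.sum_congr rfl hx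

/-- The mean-value estimate on each cell carries the cell length as a factor, and the squares `cell
× cell` are disjoint in the plane, so their energies add up to at most `‖u‖²`. The embedding is thus
a norm limit of finite-rank operators. -/
lemma X.norm_sub_averaging_le (N : ℕ) (u : X) :
    ‖X.toL2 u - averaging N (X.toL2 u)‖ ^ 2 ≤ (N + 1 : ℝ)⁻¹ * ‖u‖ ^ 2 := by
  have hN : (0 : ℝ) < (N + 1 : ℝ)⁻¹ := by positivity
  have hm := u.measurable
  have hD : Measurable (diffQuot u) := measurable_diffQuot hm
  set m : ℕ → ℝ := fun i => (N + 1 : ℝ) * ∫ y in cell N i, u y with hmdef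
  rw [← ENNReal.ofReal_le_ofReal_iff (by positivity), ofReal_norm_sq_eq_lintegral,
    ENNReal.ofReal_mul hN.le, ← u.lintegral_diffQuot]
  calc ∫⁻ x, ENNReal.ofReal ((X.toL2 u - averaging N (X.toL2 u) : L2R) x ^ 2)
      ≤ ∫⁻ x, ∑ i ∈ Finset.range (N + 1),
          (cell N i).indicator (fun x => ENNReal.ofReal ((u x - m i) ^ 2)) x := by
        refine lintegral_mono_ae ?_
        filter_upwards [Lp.coeFn_sub (X.toL2 u) (averaging N (X.toL2 u)),
          averaging_ae_eq N (X.toL2 u), u.ae_eq_zero] with x h1 h2 h3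
        rw [h1, Pi.sub_apply, h2]
        by_cases hx : ∃ i ∈ Finset.range (N + 1), x ∈ cell N i
        · obtain ⟨i, hi, hxi⟩ := hx
          rw [Finset.sum_eq_single_of_mem i hi, Set.indicator_of_mem hxi]
          · refine le_trans (le_of_eq ?_) (Finset.single_le_sum (fun _ _ => zero_le) hi)
            rw [Set.indicator_of_mem hxi]
          · intro j _ hj
            exact Set.indicator_of_notMem
              (fun h => Set.disjoint_left.1 (cell_disjoint N hj) h hxi) _
        · have h0 : u x = 0 := h3 fun h => hx (by simpa using Ioo_subset_iUnion_cell N h)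
          rw [Finset.sum_eq_zero, h0]
          · simp
          · intro j hj
            exact Set.indicator_of_notMem (fun h => hx ⟨j, hj, h⟩) _
    _ = ∑ i ∈ Finset.range (N + 1), ∫⁻ x in cell N i, ENNReal.ofReal ((u x - m i) ^ 2) := by
        rw [lintegral_finsetSum _ fun i _ =>
          Measurable.indicator (by fun_prop) (measurableSet_cell N i)]
        exact Finset.sum_congr rfl fun i _ => lintegral_indicator (measurableSet_cell N i) _
    _ ≤ ∑ i ∈ Finset.range (N + 1), ENNReal.ofReal (N + 1 : ℝ)⁻¹ *
          ∫⁻ p in cell N i ×ˢ cell N i, ENNReal.ofReal (diffQuot u p ^ 2) := by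
        refine Finset.sum_le_sum fun i _ => ?_
        have := lintegral_sub_mean_le hm (Lp.memLp (X.toL2 u)) (a := i / (N + 1 : ℝ)) hN
        rwa [inv_inv] at this
    _ = ENNReal.ofReal (N + 1 : ℝ)⁻¹ * ∫⁻ p in ⋃ i ∈ Finset.range (N + 1), cell N i ×ˢ cell N i,
          ENNReal.ofReal (diffQuot u p ^ 2) := by
        rw [← Finset.mul_sum, lintegral_biUnion_finset]
        · intro i _ j _ hij
          exact Set.disjoint_prod.2 (Or.inl (cell_disjoint N hij))
        · exact fun i _ => (measurableSet_cell N i).prod (measurableSet_cell N i)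
    _ ≤ _ := by gcongr; exact Measure.restrict_le_self

/-- The embedding of `X` into `L²(ℝ)` is compact. -/
lemma X.isCompactOperator_toL2CLM : IsCompactOperator X.toL2CLM := by
  refine isCompactOperator_of_tendsto (l := atTop)
    (F := fun N : ℕ => (averaging N).comp X.toL2CLM) ?_
    (Eventually.of_forall fun N => (isCompactOperator_averaging N).comp_clm X.toL2CLM)
  rw [tendsto_iff_norm_sub_tendsto_zero]
  have hlim : Tendsto (fun N : ℕ => √((N + 1 : ℝ)⁻¹)) atTop (𝓝 0) := by
    have : Tendsto (fun N : ℕ => ((N + 1 : ℝ)⁻¹)) atTop (𝓝 0) := by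
      simpa using tendsto_one_div_add_atTop_nhds_zero_nat (𝕜 := ℝ)
    simpa using this.sqrt
  refine squeeze_zero (fun _ => norm_nonneg _) (fun N => ?_) hlim
  refine ContinuousLinearMap.opNorm_le_bound _ (Real.sqrt_nonneg _) fun u => ?_
  have h := u.norm_sub_averaging_le N
  rw [← norm_neg]
  simp only [_root_.sub_apply, ContinuousLinearMap.comp_apply, X.toL2CLM_apply,
    neg_sub]
  refine (pow_le_pow_iff_left₀ (norm_nonneg _) (by positivity) two_ne_zero).1 ?_
  rwa [mul_pow, Real.sq_sqrt (by positivity)]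

/-! ### Convergence of integrals under approximate domination -/

/-- A variant of Vitali's convergence theorem: domination by an integrable function up to
an error with small integral. -/
lemma tendsto_lintegral_of_approx_dominated {α : Type*} [MeasurableSpace α] {μ : Measure α}
    {h : ℕ → α → ℝ≥0∞} (hm : ∀ n, AEMeasurable (h n) μ)
    (hlim : ∀ᵐ x ∂μ, Tendsto (fun n => h n x) atTop (𝓝 0))
    (hdom : ∀ η : ℝ≥0∞, 0 < η → ∃ G : α → ℝ≥0∞, AEMeasurable G μ ∧ ∫⁻ x, G x ∂μ ≠ ⊤ ∧
      ∀ᶠ n in atTop, ∃ R : α → ℝ≥0∞, ∫⁻ x, R x ∂μ ≤ η ∧ ∀ᵐ x ∂μ, h n x ≤ G x + R x) :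
    Tendsto (fun n => ∫⁻ x, h n x ∂μ) atTop (𝓝 0) := by
  rw [ENNReal.tendsto_nhds_zero]
  intro ε hε
  obtain ⟨G, hG, hGi, hR⟩ := hdom (ε / 2) (ENNReal.half_pos hε.ne')
  -- Dominated convergence applies to `min (h n) G`; the excess of `h n` over it is at most `R`.
  have h1 : Tendsto (fun n => ∫⁻ x, min (h n x) (G x) ∂μ) atTop (𝓝 (∫⁻ _, 0 ∂μ)) := by
    refine tendsto_lintegral_of_dominated_convergence' G (fun n => (hm n).min hG)
      (fun n => Eventually.of_forall fun x => min_le_right _ _) hGi ?_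
    filter_upwards [hlim] with x hx
    exact tendsto_of_tendsto_of_tendsto_of_le_of_le tendsto_const_nhds hx (fun _ => zero_le)
      (fun _ => min_le_left _ _)
  rw [lintegral_zero, ENNReal.tendsto_nhds_zero] at h1
  filter_upwards [h1 (ε / 2) (ENNReal.half_pos hε.ne'), hR] with n hn hRn
  obtain ⟨R, hRi, hRd⟩ := hRn
  calc ∫⁻ x, h n x ∂μ ≤ ∫⁻ x, min (h n x) (G x) + R x ∂μ := by
        refine lintegral_mono_ae ?_
        filter_upwards [hRd] with x hx
        rcases le_total (h n x) (G x) with hle | hle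
        · rw [min_eq_left hle]; exact le_self_add
        · rwa [min_eq_right hle]
    _ = ∫⁻ x, min (h n x) (G x) ∂μ + ∫⁻ x, R x ∂μ := lintegral_add_left' ((hm n).min hG) _
    _ ≤ ε / 2 + ε / 2 := add_le_add hn hRi
    _ = ε := ENNReal.add_halves ε

/-- The real-valued form of `tendsto_lintegral_of_approx_dominated`. -/
lemma tendsto_lintegral_ofReal_of_approx_dominated {α : Type*} [MeasurableSpace α] {μ : Measure α}
    {h : ℕ → α → ℝ} (hm : ∀ n, AEMeasurable (h n) μ)
    (hlim : ∀ᵐ x ∂μ, Tendsto (fun n => h n x) atTop (𝓝 0))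
    (hdom : ∀ η : ℝ, 0 < η → ∃ G : α → ℝ, Integrable G μ ∧
      ∀ᶠ n in atTop, ∃ R : α → ℝ, ∫⁻ x, ENNReal.ofReal (R x) ∂μ ≤ ENNReal.ofReal η ∧
        ∀ᵐ x ∂μ, h n x ≤ G x + R x) :
    Tendsto (fun n => ∫⁻ x, ENNReal.ofReal (h n x) ∂μ) atTop (𝓝 0) := by
  refine tendsto_lintegral_of_approx_dominated (fun n => (hm n).ennreal_ofReal) ?_ ?_
  · filter_upwards [hlim] with x hx
    simpa using ENNReal.tendsto_ofReal hx
  · intro η hη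
    obtain ⟨δ, hδ, hδη⟩ : ∃ δ : ℝ, 0 < δ ∧ ENNReal.ofReal δ ≤ η := by
      rcases eq_or_ne η ⊤ with rfl | hη'
      · exact ⟨1, one_pos, le_top⟩
      · exact ⟨η.toReal, ENNReal.toReal_pos hη.ne' hη', by rw [ENNReal.ofReal_toReal hη']⟩
    obtain ⟨G, hG, hR⟩ := hdom δ hδ
    refine ⟨fun x => ENNReal.ofReal (G x), hG.aemeasurable.ennreal_ofReal, ?_, ?_⟩
    · exact ((lintegral_mono fun x => Real.ofReal_le_enorm (G x)).trans_lt hG.2).ne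
    · filter_upwards [hR] with n hn
      obtain ⟨R, hRi, hRd⟩ := hn
      refine ⟨fun x => ENNReal.ofReal (R x), hRi.trans hδη, ?_⟩
      filter_upwards [hRd] with x hx
      exact (ENNReal.ofReal_le_ofReal hx).trans ENNReal.ofReal_add_le

/-- Convergence of integrals from the vanishing of `∫ |g n - g|`. -/
lemma tendsto_integral_of_tendsto_lintegral_abs {α : Type*} [MeasurableSpace α] {μ : Measure α}
    {g : ℕ → α → ℝ} {g' : α → ℝ} (hg : ∀ n, Integrable (g n) μ) (hg' : Integrable g' μ)
    (h : Tendsto (fun n => ∫⁻ x, ENNReal.ofReal |g n x - g' x| ∂μ) atTop (𝓝 0)) :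
    Tendsto (fun n => ∫ x, g n x ∂μ) atTop (𝓝 (∫ x, g' x ∂μ)) := by
  refine tendsto_integral_of_L1 g' hg'.1 (Eventually.of_forall hg) ?_
  simpa only [Real.enorm_eq_ofReal_abs] using h

/-! ### Bounded sequences in `X`: a.e. and weak limits -/

lemma ae_tendsto_diffQuot {u : ℕ → ℝ → ℝ} {v : ℝ → ℝ}
    (h : ∀ᵐ x : ℝ, Tendsto (fun n => u n x) atTop (𝓝 (v x))) :
    ∀ᵐ p : ℝ × ℝ, Tendsto (fun n => diffQuot (u n) p) atTop (𝓝 (diffQuot v p)) := by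
  have h1 : ∀ᵐ p : ℝ × ℝ, Tendsto (fun n => u n p.1) atTop (𝓝 (v p.1)) :=
    (Measure.quasiMeasurePreserving_fst (μ := (volume : Measure ℝ))
      (ν := (volume : Measure ℝ))).ae h
  have h2 : ∀ᵐ p : ℝ × ℝ, Tendsto (fun n => u n p.2) atTop (𝓝 (v p.2)) :=
    (Measure.quasiMeasurePreserving_snd (μ := (volume : Measure ℝ))
      (ν := (volume : Measure ℝ))).ae h
  filter_upwards [h1, h2] with p hp1 hp2
  exact (hp1.sub hp2).div_const _

/-- An element of `X` from a function in `L²(ℝ)` with square integrable difference quotient. -/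
noncomputable def X.mk (u : L2R) (h : MemLp (diffQuot u) 2 (volume : Measure (ℝ × ℝ)))
    (h0 : ∀ᵐ x : ℝ, x ∉ Set.Ioo (0 : ℝ) 1 → u x = 0) : X :=
  ⟨u, (memHHalf_iff u).2 h, h0⟩

/-- A bounded sequence in `X` has a subsequence that converges almost everywhere to an
element of `X`. -/
lemma X.exists_subseq_ae_tendsto {u : ℕ → X} {R : ℝ} (hR : ∀ n, ‖u n‖ ≤ R) :
    ∃ (v : X) (k : ℕ → ℕ), StrictMono k ∧
      ∀ᵐ x : ℝ, Tendsto (fun n => u (k n) x) atTop (𝓝 (v x)) := by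
  obtain ⟨K, hK, hKs⟩ :=
    X.isCompactOperator_toL2CLM.image_closedBall_subset_compact (f := X.toL2CLM.toLinearMap) R
  have hmem : ∀ n, X.toL2 (u n) ∈ K := fun n =>
    hKs ⟨u n, by simpa using hR n, rfl⟩
  obtain ⟨w, -, k₁, hk₁, hw⟩ := hK.tendsto_subseq hmem
  have hmeas := tendstoInMeasure_of_tendsto_Lp hw
  obtain ⟨k₂, hk₂, hae⟩ := hmeas.exists_seq_tendsto_ae
  have hae' : ∀ᵐ x : ℝ, Tendsto (fun n => u (k₁ (k₂ n)) x) atTop (𝓝 (w x)) := hae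
  have h0 : ∀ᵐ x : ℝ, x ∉ Set.Ioo (0 : ℝ) 1 → w x = 0 := by
    have : ∀ᵐ x : ℝ, ∀ n, x ∉ Set.Ioo (0 : ℝ) 1 → u n x = 0 :=
      ae_all_iff.2 fun n => (u n).ae_eq_zero
    filter_upwards [this, hae'] with x hx hx' hxI
    refine tendsto_nhds_unique hx' ?_
    simp [hx _ hxI]
  -- Fatou's lemma for the squared difference quotients keeps the limit in `X`.
  have hD : MemLp (diffQuot w) 2 (volume : Measure (ℝ × ℝ)) := by
    refine (memLp_two_iff_integrable_sq (diffQuot_aesm w)).2 ⟨(diffQuot_aesm w).pow 2, ?_⟩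
    rw [hasFiniteIntegral_iff_ofReal (Eventually.of_forall fun _ => sq_nonneg _)]
    calc ∫⁻ p, ENNReal.ofReal (diffQuot w p ^ 2)
        = ∫⁻ p, liminf (fun n => ENNReal.ofReal (diffQuot (u (k₁ (k₂ n))) p ^ 2)) atTop := by
          refine lintegral_congr_ae ?_
          filter_upwards [ae_tendsto_diffQuot hae'] with p hp
          exact (ENNReal.tendsto_ofReal (hp.pow 2)).liminf_eq.symm
      _ ≤ liminf (fun n => ∫⁻ p, ENNReal.ofReal (diffQuot (u (k₁ (k₂ n))) p ^ 2)) atTop :=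
          lintegral_liminf_le fun n =>
            ((measurable_diffQuot (X.measurable _)).pow_const 2).ennreal_ofReal
      _ ≤ ENNReal.ofReal (R ^ 2) := by
          refine liminf_le_of_frequently_le' (Eventually.frequently (Eventually.of_forall ?_))
          intro n
          rw [X.lintegral_diffQuot]
          exact ENNReal.ofReal_le_ofReal (pow_le_pow_left₀ (norm_nonneg _) (hR _) 2)
      _ < ⊤ := ENNReal.ofReal_lt_top
  exact ⟨X.mk w hD h0, k₁ ∘ k₂, hk₁.comp hk₂, hae'⟩

/-- A bounded sequence in `X` that converges almost everywhere converges weakly. -/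
lemma X.tendsto_inner_of_ae_tendsto {u : ℕ → X} {v : X} {R : ℝ} (hR : ∀ n, ‖u n‖ ≤ R)
    (h : ∀ᵐ x : ℝ, Tendsto (fun n => u n x) atTop (𝓝 (v x))) (z : X) :
    Tendsto (fun n => inner ℝ (u n) z) atTop (𝓝 (inner ℝ v z)) := by
  simp only [X.inner_eq]
  have i1 : ∀ w : X, Integrable (fun p => diffQuot w p * diffQuot z p) :=
    fun w => MemLp.integrable_mul w.memLp_diffQuot z.memLp_diffQuot
  have i2 : ∀ w : X, Integrable (fun p => diffQuot w p ^ 2) :=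
    fun w => w.memLp_diffQuot.integrable_sq
  refine tendsto_integral_of_tendsto_lintegral_abs (fun n => i1 (u n)) (i1 v) ?_
  refine tendsto_lintegral_ofReal_of_approx_dominated
    (fun n => ((i1 (u n)).sub (i1 v)).abs.aemeasurable) ?_ ?_
  · filter_upwards [ae_tendsto_diffQuot h] with p hp
    have := ((hp.mul_const (diffQuot z p)).sub_const (diffQuot v p * diffQuot z p)).abs
    simpa using this
  · intro η hη
    -- Weight in Young's inequality `|ab| ≤ δ a² + δ⁻¹ b²`, chosen so that `δ ‖u n‖² ≤ η`.
    set δ : ℝ := η / (R ^ 2 + 1) with hδ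
    have hδ0 : 0 < δ := by positivity
    refine ⟨fun p => |diffQuot v p * diffQuot z p| + δ⁻¹ * diffQuot z p ^ 2,
      (i1 v).abs.add ((i2 z).const_mul _), Eventually.of_forall fun n => ?_⟩
    refine ⟨fun p => δ * diffQuot (u n) p ^ 2, ?_, Eventually.of_forall fun p => ?_⟩
    · simp only [ENNReal.ofReal_mul hδ0.le]
      rw [lintegral_const_mul' _ _ ENNReal.ofReal_ne_top, X.lintegral_diffQuot,
        ← ENNReal.ofReal_mul hδ0.le]
      refine ENNReal.ofReal_le_ofReal ?_
      rw [hδ, div_mul_eq_mul_div, div_le_iff₀ (by positivity)]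
      have := pow_le_pow_left₀ (norm_nonneg _) (hR n) 2
      nlinarith
    · have h1 : |diffQuot (u n) p * diffQuot z p| ≤
          δ⁻¹ * diffQuot z p ^ 2 + δ * diffQuot (u n) p ^ 2 := by
        have e : δ⁻¹ * diffQuot z p ^ 2 + δ * diffQuot (u n) p ^ 2 -
            2 * |diffQuot (u n) p * diffQuot z p| =
            δ⁻¹ * (|diffQuot z p| - δ * |diffQuot (u n) p|) ^ 2 := by
          rw [abs_mul, sub_sq, mul_pow, sq_abs, sq_abs]; field_simp; ring
        have : 0 ≤ δ⁻¹ * (|diffQuot z p| - δ * |diffQuot (u n) p|) ^ 2 := by positivity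
        linarith [abs_nonneg (diffQuot (u n) p * diffQuot z p)]
      have h2 := abs_sub (diffQuot (u n) p * diffQuot z p) (diffQuot v p * diffQuot z p)
      linarith

/-! ### Truncation and density of bounded functions -/

/-- Truncation at height `k`. -/
noncomputable def trunc (k : ℕ) (t : ℝ) : ℝ := max (-k) (min k t)

lemma lipschitzWith_trunc (k : ℕ) : LipschitzWith 1 (trunc k) := by
  unfold trunc
  exact (LipschitzWith.id.const_min _).const_max _

lemma trunc_zero (k : ℕ) : trunc k 0 = 0 := by simp [trunc]

lemma abs_trunc_le (k : ℕ) (t : ℝ) : |trunc k t| ≤ k := by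
  have hk : (0 : ℝ) ≤ k := Nat.cast_nonneg k
  refine abs_le.2 ⟨le_max_left _ _, max_le (by linarith) (min_le_left _ _)⟩

lemma abs_trunc_sub_le (k : ℕ) (s t : ℝ) : |trunc k s - trunc k t| ≤ |s - t| := by
  simpa [Real.dist_eq] using (lipschitzWith_trunc k).dist_le_mul s t

lemma trunc_eq_self {k : ℕ} {t : ℝ} (h : |t| ≤ k) : trunc k t = t := by
  rw [abs_le] at h
  rw [trunc, min_eq_right h.2, max_eq_right h.1]

lemma tendsto_trunc (t : ℝ) : Tendsto (fun k => trunc k t) atTop (𝓝 t) := by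
  refine tendsto_const_nhds.congr' ?_
  filter_upwards [eventually_ge_atTop ⌈|t|⌉₊] with k hk
  exact (trunc_eq_self ((Nat.le_ceil _).trans (by exact_mod_cast hk))).symm

lemma abs_diffQuot_trunc_le (k : ℕ) (u : ℝ → ℝ) (p : ℝ × ℝ) :
    |diffQuot (fun x => trunc k (u x)) p| ≤ |diffQuot u p| := by
  simp only [diffQuot, abs_div, abs_abs]
  exact div_le_div_of_nonneg_right (abs_trunc_sub_le k _ _) (abs_nonneg _)

lemma coeFn_compLp_trunc (k : ℕ) (u : L2R) :
    ((lipschitzWith_trunc k).compLp (trunc_zero k) u : L2R) =ᵐ[volume] fun x => trunc k (u x) :=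
  (lipschitzWith_trunc k).coeFn_compLp (trunc_zero k) u

/-- Truncation on `X`. -/
noncomputable def X.trunc (k : ℕ) (u : X) : X :=
  X.mk ((lipschitzWith_trunc k).compLp (trunc_zero k) (X.toL2 u))
    (u.memLp_diffQuot.mono (diffQuot_aesm _) (by
      filter_upwards [diffQuot_congr (coeFn_compLp_trunc k (X.toL2 u))] with p hp
      rw [hp]
      exact abs_diffQuot_trunc_le k _ p))
    (by
      filter_upwards [coeFn_compLp_trunc k (X.toL2 u), u.ae_eq_zero] with x hx hx0 hxI
      rw [hx, hx0 hxI, trunc_zero])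

lemma X.trunc_ae_eq (k : ℕ) (u : X) : X.trunc k u =ᵐ[volume] fun x => HalfLap.trunc k (u x) :=
  coeFn_compLp_trunc k (X.toL2 u)

lemma X.diffQuot_sub_ae_eq (u v : X) :
    diffQuot (u - v : X) =ᵐ[volume] fun p => diffQuot u p - diffQuot v p := by
  have h : (u - v : X) =ᵐ[volume] fun x => u x - v x := by
    rw [map_sub]; exact Lp.coeFn_sub _ _
  refine (diffQuot_congr h).trans (Eventually.of_forall fun p => ?_)
  simp only [diffQuot]; ring

/-- Truncation is 1-Lipschitz and so does not increase difference quotients; dominated convergence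
applies with majorant `4 (diffQuot u)²`. -/
lemma X.tendsto_trunc (u : X) : Tendsto (fun k => X.trunc k u) atTop (𝓝 u) := by
  rw [tendsto_iff_norm_sub_tendsto_zero]
  suffices h : Tendsto (fun k => ‖X.trunc k u - u‖ ^ 2) atTop (𝓝 0) by
    simpa [Real.sqrt_sq (norm_nonneg _)] using h.sqrt
  simp only [X.norm_sq]
  have h0 : (0 : ℝ) = ∫ _ : ℝ × ℝ, (0 : ℝ) := by simp
  rw [h0]
  refine tendsto_integral_of_dominated_convergence (fun p => 4 * diffQuot u p ^ 2)
    (fun k => ((diffQuot_aesm _).pow 2)) (u.memLp_diffQuot.integrable_sq.const_mul 4)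
    (fun k => ?_) ?_
  · filter_upwards [X.diffQuot_sub_ae_eq (X.trunc k u) u, diffQuot_congr (X.trunc_ae_eq k u)]
      with p hp hp'
    rw [hp, hp', Real.norm_eq_abs, abs_of_nonneg (sq_nonneg _)]
    have h1 := abs_diffQuot_trunc_le k u p
    have h2 : |diffQuot (fun x => HalfLap.trunc k (u x)) p - diffQuot u p| ≤
      2 * |diffQuot u p| := (abs_sub _ _).trans (by linarith)
    have h3 := pow_le_pow_left₀ (abs_nonneg _) h2 2
    rw [sq_abs, mul_pow, sq_abs] at h3
    linarith
  · have h1 : ∀ᵐ p : ℝ × ℝ, ∀ k, diffQuot (X.trunc k u - u : X) p =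
        diffQuot (fun x => HalfLap.trunc k (u x)) p - diffQuot u p := by
      refine ae_all_iff.2 fun k => ?_
      filter_upwards [X.diffQuot_sub_ae_eq (X.trunc k u) u, diffQuot_congr (X.trunc_ae_eq k u)]
        with p hp hp'
      rw [hp, hp']
    have h2 := ae_tendsto_diffQuot (u := fun k x => HalfLap.trunc k (u x)) (v := u)
      (Eventually.of_forall fun x => HalfLap.tendsto_trunc (u x))
    filter_upwards [h1, h2] with p hp hp'
    simp only [hp]
    simpa using ((hp'.sub_const (diffQuot u p)).pow 2)

/-! ### Exponential integrability -/

/-- Lebesgue measure on `(0,1)`. -/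
noncomputable abbrev unitMeasure : Measure ℝ := volume.restrict (Set.Ioo (0 : ℝ) 1)

instance : IsProbabilityMeasure unitMeasure := ⟨by simp⟩

lemma X.quarterLapNorm_le_one {v : X} (hv : ‖v‖ ^ 2 ≤ 2 * Real.pi) :
    quarterLapNorm (X.toL2 v) ≤ 1 := by
  have h := v.quarterLapNorm_sq
  have h2 : ENNReal.ofReal (2 * Real.pi) * quarterLapNorm (X.toL2 v) ^ 2 ≤
      ENNReal.ofReal (2 * Real.pi) * 1 := by
    rw [h, mul_one]; exact ENNReal.ofReal_le_ofReal hv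
  rw [ENNReal.mul_le_mul_iff_right (by simp [Real.pi_pos]) ENNReal.ofReal_ne_top] at h2
  by_contra hc
  exact absurd h2 (not_le.2 (one_lt_pow₀ (not_le.1 hc) two_ne_zero))

/-- The Trudinger–Moser inequality on `X`. -/
lemma exists_lintegral_exp_le {A ρ : ℝ} (hA : 0 < A) (hρ : 0 < ρ) (h : A * ρ < omega) :
    ∃ C : ℝ, 0 < C ∧ ∀ w : X, ‖w‖ ^ 2 ≤ 2 * Real.pi * ρ →
      ∫⁻ x, ENNReal.ofReal (Real.exp (A * w x ^ 2)) ∂unitMeasure ≤ ENNReal.ofReal C := by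
  -- The real supremum of the empty set is `0`, which `0 < A * ρ < omega` excludes.
  have hne : {w : ℝ | TrudingerMoser w}.Nonempty := by
    by_contra hc
    rw [Set.not_nonempty_iff_eq_empty] at hc
    rw [omega, hc, Real.sSup_empty] at h
    exact absurd h (not_lt.2 (by positivity))
  obtain ⟨w₀, hw₀, hlt⟩ := exists_lt_of_lt_csSup hne h
  obtain ⟨H, hH, hTM⟩ := hw₀.2.2 (A * ρ) (by positivity) hlt
  -- `18π = 3² · 2π` bounds the squared `L²` norm of the rescaled function `ρ^{-1/2} w` by Poincaré;
  -- the `1` is the integral of the constant removed from the exponential.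
  refine ⟨H * (18 * Real.pi) + 1, by positivity, fun w hw => ?_⟩
  set s : ℝ := (√ρ)⁻¹ with hs
  have hs2 : s ^ 2 = ρ⁻¹ := by rw [hs, inv_pow, Real.sq_sqrt hρ.le]
  have hv : ‖s • w‖ ^ 2 ≤ 2 * Real.pi := by
    rw [norm_smul, mul_pow, Real.norm_eq_abs, sq_abs, hs2, inv_mul_le_iff₀ hρ]
    linarith
  have h1 := hTM (X.toL2 (s • w)) (s • w).2.1 (X.quarterLapNorm_le_one hv)
  have h2 : ‖X.toL2 (s • w)‖ ^ 2 ≤ 18 * Real.pi := by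
    have := pow_le_pow_left₀ (norm_nonneg _) (X.norm_toL2_le (s • w)) 2
    rw [mul_pow] at this
    linarith
  have hm := w.measurable
  calc ∫⁻ x, ENNReal.ofReal (Real.exp (A * w x ^ 2)) ∂unitMeasure
      ≤ ∫⁻ x, (ENNReal.ofReal (Real.exp (A * w x ^ 2) - 1) + 1) ∂unitMeasure := by
        refine lintegral_mono fun x => ?_
        rw [← ENNReal.ofReal_one, ← ENNReal.ofReal_add _ zero_le_one]
        · simp
        · have := Real.one_le_exp (by positivity : 0 ≤ A * w x ^ 2)
          linarith
    _ = (∫⁻ x, ENNReal.ofReal (Real.exp (A * w x ^ 2) - 1) ∂unitMeasure) + 1 := by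
        rw [lintegral_add_right _ measurable_const]; simp
    _ ≤ (∫⁻ x, ENNReal.ofReal (Real.exp (A * w x ^ 2) - 1)) + 1 := by
        gcongr; exact Measure.restrict_le_self
    _ = (∫⁻ x, ENNReal.ofReal (Real.exp (A * ρ * X.toL2 (s • w) x ^ 2) - 1)) + 1 := by
        congr 1
        refine lintegral_congr_ae ?_
        have : X.toL2 (s • w) =ᵐ[volume] fun x => s * w x := by
          rw [map_smul]; exact Lp.coeFn_smul _ _
        filter_upwards [this] with x hx
        rw [hx, mul_pow, hs2, mul_assoc, mul_inv_cancel_left₀ hρ.ne']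
    _ ≤ ENNReal.ofReal (H * (18 * Real.pi)) + ENNReal.ofReal 1 := by
        rw [ENNReal.ofReal_one]
        gcongr
        exact h1.trans (ENNReal.ofReal_le_ofReal (by gcongr))
    _ = _ := (ENNReal.ofReal_add (by positivity) zero_le_one).symm

lemma X.sub_ae_eq (u v : X) : (u - v : X) =ᵐ[volume] fun x => u x - v x := by
  rw [map_sub]; exact Lp.coeFn_sub _ _

lemma X.add_ae_eq (u v : X) : (u + v : X) =ᵐ[volume] fun x => u x + v x := by
  rw [map_add]; exact Lp.coeFn_add _ _

/-- Exponential integrability on `X` of every order. -/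
lemma X.integrable_exp (hω : 0 < omega) (u : X) (B : ℝ) :
    Integrable (fun x => Real.exp (B * u x ^ 2)) unitMeasure := by
  have hm := u.measurable
  refine ⟨by fun_prop, ?_⟩
  rw [hasFiniteIntegral_iff_ofReal (Eventually.of_forall fun _ => (Real.exp_pos _).le)]
  set b : ℝ := |B| + 1 with hb
  have hb0 : 0 < b := by positivity
  have hBb : B ≤ b := (le_abs_self B).trans (by linarith)
  -- Split `u` into a truncation, bounded by `k`, and a rest of small norm, with `u² ≤ 2k² + 2(u -
  -- t)²`. The rest needs exponent `2b`, and `2bρ = ω/2 < ω`.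
  set ρ : ℝ := omega / (4 * b) with hρ
  have hρ0 : 0 < ρ := by positivity
  obtain ⟨C, -, hC⟩ := exists_lintegral_exp_le (A := 2 * b) (ρ := ρ) (by positivity) hρ0 (by
    rw [hρ]; field_simp; linarith)
  have hlim : Tendsto (fun k => ‖u - X.trunc k u‖ ^ 2) atTop (𝓝 0) := by
    have := ((tendsto_const_nhds (x := u)).sub u.tendsto_trunc).norm.pow 2
    simpa using this
  obtain ⟨k, hk⟩ := (hlim.eventually_le_const
    (by positivity : (0 : ℝ) < 2 * Real.pi * ρ)).exists
  calc ∫⁻ x, ENNReal.ofReal (Real.exp (B * u x ^ 2)) ∂unitMeasure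
      ≤ ∫⁻ x, ENNReal.ofReal (Real.exp (2 * b * k ^ 2)) *
          ENNReal.ofReal (Real.exp (2 * b * (u - X.trunc k u : X) x ^ 2)) ∂unitMeasure := by
        refine lintegral_mono_ae (ae_restrict_of_ae ?_)
        filter_upwards [X.sub_ae_eq u (X.trunc k u), X.trunc_ae_eq k u] with x hx hx'
        rw [← ENNReal.ofReal_mul (Real.exp_pos _).le, ← Real.exp_add, hx, hx']
        refine ENNReal.ofReal_le_ofReal (Real.exp_le_exp.2 ?_)
        set t := HalfLap.trunc k (u x)
        have h1 : t ^ 2 ≤ (k : ℝ) ^ 2 := by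
          have := pow_le_pow_left₀ (abs_nonneg _) (abs_trunc_le k (u x)) 2
          rwa [sq_abs] at this
        have h2 : u x ^ 2 ≤ 2 * (k : ℝ) ^ 2 + 2 * (u x - t) ^ 2 := by
          nlinarith [sq_nonneg (u x - 2 * t)]
        calc B * u x ^ 2 ≤ b * u x ^ 2 := by gcongr
          _ ≤ b * (2 * (k : ℝ) ^ 2 + 2 * (u x - t) ^ 2) := by gcongr
          _ = _ := by ring
    _ = ENNReal.ofReal (Real.exp (2 * b * k ^ 2)) *
          ∫⁻ x, ENNReal.ofReal (Real.exp (2 * b * (u - X.trunc k u : X) x ^ 2)) ∂unitMeasure :=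
        lintegral_const_mul' _ _ ENNReal.ofReal_ne_top
    _ < ⊤ := ENNReal.mul_lt_top ENNReal.ofReal_lt_top
        ((hC _ hk).trans_lt ENNReal.ofReal_lt_top)

/-- Supplies approximate domination: `s` is the value of a fixed function, `w` that of a
perturbation. If `|w| ≤ R`, the `w`-factors are bounded. If `|w| ≥ R` and `b s²` is small against
`w²`, the gap `A' - A` absorbs everything. Otherwise `w²` is controlled by `s²`. -/
lemma one_add_abs_mul_exp_le {A A' b η : ℝ} (hA : 0 ≤ A) (hAA : A < A') (hb : 0 ≤ b)
    (hη : 0 < η) :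
    ∃ K B : ℝ, 0 ≤ K ∧ ∀ w s : ℝ,
      (1 + |w|) * Real.exp (A * w ^ 2 + b * s ^ 2) ≤
        K * Real.exp (B * s ^ 2) + η * Real.exp (A' * w ^ 2) := by
  set δ := A' - A with hδ
  have hδ0 : 0 < δ := sub_pos.2 hAA
  -- For `|w| ≥ R` this gives `1 + |w| ≤ 2|w| ≤ η (δ/2) w²`.
  set R : ℝ := 1 + 4 / (δ * η) with hR
  have hR1 : 1 ≤ R := by rw [hR]; linarith [show 0 < 4 / (δ * η) by positivity]
  -- Comes from `1 + |w| ≤ 2 exp(w²)` and `w² ≤ (2b/δ) s²` in the third case.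
  set B : ℝ := (A + 1) * (2 * b / δ) + b with hB
  have hbB : b ≤ B := by rw [hB]; linarith [show 0 ≤ (A + 1) * (2 * b / δ) by positivity]
  refine ⟨(1 + R) * Real.exp (A * R ^ 2) + 2, B, by positivity, fun w s => ?_⟩
  have hE1 : 0 < Real.exp (B * s ^ 2) := Real.exp_pos _
  have hE2 : 0 < η * Real.exp (A' * w ^ 2) := by positivity
  rcases le_total |w| R with hw | hw
  · have h1 : w ^ 2 ≤ R ^ 2 := by rw [← sq_abs]; gcongr
    have h2 : (1 + |w|) * Real.exp (A * w ^ 2 + b * s ^ 2) ≤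
        (1 + R) * Real.exp (A * R ^ 2) * Real.exp (B * s ^ 2) := by
      rw [mul_assoc, ← Real.exp_add]
      gcongr
    linarith
  · rcases le_total (b * s ^ 2) (δ / 2 * w ^ 2) with hs | hs
    · have hw0 : 0 < |w| := by linarith
      have h1 : 1 + |w| ≤ η * Real.exp (δ / 2 * w ^ 2) := by
        have h2 : δ / 2 * w ^ 2 ≤ Real.exp (δ / 2 * w ^ 2) := by
          linarith [Real.add_one_le_exp (δ / 2 * w ^ 2)]
        have h3 : 1 + |w| ≤ 2 * |w| := by linarith
        have h4 : 4 / (δ * η) ≤ |w| := by linarith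
        rw [div_le_iff₀ (by positivity)] at h4
        have h5 : 2 * |w| ≤ η * (δ / 2 * w ^ 2) := by
          rw [← sq_abs w]
          nlinarith
        calc _ ≤ _ := h3
          _ ≤ _ := h5
          _ ≤ _ := by gcongr
      have h6 : (1 + |w|) * Real.exp (A * w ^ 2 + b * s ^ 2) ≤ η * Real.exp (A' * w ^ 2) := by
        calc (1 + |w|) * Real.exp (A * w ^ 2 + b * s ^ 2)
            ≤ η * Real.exp (δ / 2 * w ^ 2) * Real.exp (A * w ^ 2 + δ / 2 * w ^ 2) := by gcongr
          _ = η * Real.exp (A' * w ^ 2) := by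
            rw [mul_assoc, ← Real.exp_add, hδ]; ring_nf
      have : 0 ≤ ((1 + R) * Real.exp (A * R ^ 2) + 2) * Real.exp (B * s ^ 2) := by positivity
      linarith
    · have h1 : w ^ 2 ≤ 2 * b / δ * s ^ 2 := by
        rw [div_mul_eq_mul_div, le_div_iff₀ hδ0]; linarith
      have h2 : 1 + |w| ≤ 2 * Real.exp (w ^ 2) := by
        have := Real.add_one_le_exp (w ^ 2)
        have h3 := sq_abs w
        nlinarith [sq_nonneg (|w| - 1)]
      have h4 : (1 + |w|) * Real.exp (A * w ^ 2 + b * s ^ 2) ≤ 2 * Real.exp (B * s ^ 2) := by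
        calc (1 + |w|) * Real.exp (A * w ^ 2 + b * s ^ 2)
            ≤ 2 * Real.exp (w ^ 2) * Real.exp (A * w ^ 2 + b * s ^ 2) := by gcongr
          _ = 2 * Real.exp ((A + 1) * w ^ 2 + b * s ^ 2) := by
            rw [mul_assoc, ← Real.exp_add]; ring_nf
          _ ≤ 2 * Real.exp ((A + 1) * (2 * b / δ * s ^ 2) + b * s ^ 2) := by gcongr
          _ = _ := by rw [hB]; ring_nf
      have : 0 ≤ (1 + R) * Real.exp (A * R ^ 2) * Real.exp (B * s ^ 2) := by positivity
      linarith

/-! ### Growth of the nonlinearity -/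

section Nonlinearity

variable {f : ℝ → ℝ} {α₀ : ℝ}

lemma hasDerivAt_primitive (hf : Continuous f) (t : ℝ) : HasDerivAt (primitive f) (f t) t :=
  intervalIntegral.integral_hasDerivAt_right (hf.intervalIntegrable _ _)
    (hf.stronglyMeasurableAtFilter _ _) hf.continuousAt

lemma continuous_primitive (hf : Continuous f) : Continuous (primitive f) :=
  continuous_iff_continuousAt.2 fun t => (hasDerivAt_primitive hf t).continuousAt

lemma primitive_zero : primitive f 0 = 0 := by simp [primitive]

lemma CriticalHyp.omega_pos (hf : CriticalHyp f α₀) : 0 < omega := by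
  have h := hf.exponent_pos.trans hf.exponent_lt
  exact (mul_pos_iff_of_pos_left Real.two_pi_pos).1 h

lemma CriticalHyp.primitive_nonneg (hf : CriticalHyp f α₀) (t : ℝ) : 0 ≤ primitive f t := by
  rcases eq_or_ne t 0 with rfl | ht
  · rw [primitive_zero]
  · linarith [(hf.superquadratic t ht).1]

lemma CriticalHyp.two_mul_primitive_le (hf : CriticalHyp f α₀) (t : ℝ) :
    2 * primitive f t ≤ f t * t := by
  rcases eq_or_ne t 0 with rfl | ht
  · simp [primitive_zero]
  · exact (hf.superquadratic t ht).2

lemma CriticalHyp.mul_self_nonneg (hf : CriticalHyp f α₀) (t : ℝ) : 0 ≤ f t * t := by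
  linarith [hf.primitive_nonneg t, hf.two_mul_primitive_le t]

lemma exists_abs_le_of_continuous (hf : Continuous f) (K : ℝ) :
    ∃ C : ℝ, 0 ≤ C ∧ ∀ t, |t| ≤ K → |f t| ≤ C := by
  obtain ⟨C, hC⟩ := (isCompact_Icc (a := -K) (b := K)).exists_bound_of_continuousOn hf.continuousOn
  exact ⟨max C 0, le_max_right _ _, fun t ht => (hC t (abs_le.1 ht)).trans (le_max_left _ _)⟩

lemma CriticalHyp.exists_abs_le_exp (hf : CriticalHyp f α₀) {α : ℝ} (hα : α₀ < α) :
    ∃ C : ℝ, 0 < C ∧ ∀ t, |f t| ≤ C * Real.exp (α * t ^ 2) := by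
  have h1 := (hf.growth_above α hα).eventually_le_const (zero_lt_one)
  rw [eventually_comap] at h1
  obtain ⟨T, hT⟩ := eventually_atTop.1 h1
  obtain ⟨C, hC0, hC⟩ := exists_abs_le_of_continuous hf.continuous T
  have hα0 : 0 < α := hf.exponent_pos.trans hα
  refine ⟨C + 1, by positivity, fun t => ?_⟩
  have hexp : 1 ≤ Real.exp (α * t ^ 2) := Real.one_le_exp (by positivity)
  rcases le_total |t| T with ht | ht
  · nlinarith [hC t ht]
  · have := hT _ ht t rfl
    rw [div_le_one (Real.exp_pos _)] at this
    nlinarith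

/-- For `|t| ≥ 1/ε`, `|f(t)| ≤ ε |f(t)||t| = ε f(t)t`. A bound on `∫ f(u_n)u_n` thus makes `f(u_n)`
uniformly integrable. -/
lemma CriticalHyp.exists_abs_le_add (hf : CriticalHyp f α₀) {ε : ℝ} (hε : 0 < ε) :
    ∃ C : ℝ, 0 ≤ C ∧ ∀ t, |f t| ≤ C + ε * (f t * t) := by
  obtain ⟨C, hC0, hC⟩ := exists_abs_le_of_continuous hf.continuous ε⁻¹
  refine ⟨C, hC0, fun t => ?_⟩
  have h0 := hf.mul_self_nonneg t
  rcases le_total |t| ε⁻¹ with ht | ht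
  · linarith [hC t ht, mul_nonneg hε.le h0]
  · have h1 : f t * t = |f t| * |t| := by rw [← abs_mul, abs_of_nonneg h0]
    have h2 : 1 ≤ ε * |t| := by rwa [inv_le_iff_one_le_mul₀' hε] at ht
    rw [h1]
    nlinarith [abs_nonneg (f t)]

lemma CriticalHyp.exists_primitive_le_add (hf : CriticalHyp f α₀) :
    ∃ C M : ℝ, 0 ≤ C ∧ 0 < M ∧ ∀ t, primitive f t ≤ C + M * |f t| := by
  obtain ⟨t₀, M, -, hM, h⟩ := hf.bound
  obtain ⟨C, hC0, hC⟩ := exists_abs_le_of_continuous (continuous_primitive hf.continuous) t₀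
  refine ⟨C, M, hC0, hM, fun t => ?_⟩
  rcases le_total |t| t₀ with ht | ht
  · have := (le_abs_self _).trans (hC t ht)
    have : 0 ≤ M * |f t| := by positivity
    linarith
  · linarith [(h t ht).2]

/-- `|f|` is at most a multiple of `exp((α₀+1)t²)`, and exponentials of every order are integrable
along `u`. -/
lemma CriticalHyp.memLp_comp (hf : CriticalHyp f α₀) (u : X) :
    MemLp (fun x => f (u x)) 2 unitMeasure := by
  have hm := u.measurable
  have hfm := hf.continuous.measurable
  obtain ⟨C, hC0, hC⟩ := hf.exists_abs_le_exp (lt_add_one α₀)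
  have h : MemLp (fun x => C * Real.exp ((α₀ + 1) * u x ^ 2)) 2 unitMeasure := by
    refine MemLp.const_mul ?_ C
    refine (memLp_two_iff_integrable_sq (by fun_prop)).2 ?_
    have := X.integrable_exp hf.omega_pos u (2 * (α₀ + 1))
    refine this.congr (Eventually.of_forall fun x => ?_)
    simp only [← Real.exp_nat_mul]
    push_cast; ring_nf
  refine h.mono' (hfm.comp hm).aestronglyMeasurable (Eventually.of_forall fun x => hC (u x))

lemma X.memLp_unit (u : X) : MemLp u 2 unitMeasure := (Lp.memLp (X.toL2 u)).restrict _

lemma CriticalHyp.integrable_comp_mul (hf : CriticalHyp f α₀) (u v : X) :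
    Integrable (fun x => f (u x) * v x) unitMeasure :=
  MemLp.integrable_mul (hf.memLp_comp u) v.memLp_unit

lemma CriticalHyp.integrable_comp (hf : CriticalHyp f α₀) (u : X) :
    Integrable (fun x => f (u x)) unitMeasure := (hf.memLp_comp u).integrable (by norm_num)

lemma CriticalHyp.integrable_primitive (hf : CriticalHyp f α₀) (u : X) :
    Integrable (fun x => primitive f (u x)) unitMeasure := by
  have hm := u.measurable
  have hFm := (continuous_primitive hf.continuous).measurable
  refine (hf.integrable_comp_mul u u).mono' (hFm.comp hm).aestronglyMeasurable
    (Eventually.of_forall fun x => ?_)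
  rw [Real.norm_eq_abs, abs_of_nonneg (hf.primitive_nonneg _)]
  linarith [hf.primitive_nonneg (u x), hf.two_mul_primitive_le (u x)]

end Nonlinearity

lemma abs_integral_mul_le_sqrt_mul_sqrt {α : Type*} [MeasurableSpace α] {μ : Measure α}
    {g h : α → ℝ} (hg : MemLp g 2 μ) (hh : MemLp h 2 μ) :
    |∫ x, g x * h x ∂μ| ≤ √(∫ x, g x ^ 2 ∂μ) * √(∫ x, h x ^ 2 ∂μ) := by
  have key : ∀ {a b : α → ℝ} (ha : MemLp a 2 μ) (hb : MemLp b 2 μ),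
      inner ℝ (ha.toLp a) (hb.toLp b) = ∫ x, a x * b x ∂μ := by
    intro a b ha hb
    rw [L2.inner_def]
    refine integral_congr_ae ?_
    filter_upwards [ha.coeFn_toLp, hb.coeFn_toLp] with x h1 h2
    rw [h1, h2]
    simp [mul_comm]
  have hn : ∀ {a : α → ℝ} (ha : MemLp a 2 μ), ‖ha.toLp a‖ = √(∫ x, a x ^ 2 ∂μ) := by
    intro a ha
    rw [norm_eq_sqrt_real_inner, key ha ha]
    simp only [sq]
  rw [← key hg hh, ← hn hg, ← hn hh]
  exact abs_real_inner_le_norm _ _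

lemma X.sqrt_setIntegral_sq_le (v : X) : √(∫ x, v x ^ 2 ∂unitMeasure) ≤ 3 * ‖v‖ := by
  refine le_trans (Real.sqrt_le_iff.2 ⟨norm_nonneg _, ?_⟩) v.norm_toL2_le
  have h : Integrable (fun x => v x ^ 2) := (Lp.memLp (X.toL2 v)).integrable_sq
  have h2 : ∫ x, v x ^ 2 = ‖X.toL2 v‖ ^ 2 := by
    rw [← real_inner_self_eq_norm_sq, L2.inner_def]
    simp [sq]
  rw [← h2]
  exact setIntegral_le_integral h (Eventually.of_forall fun _ => sq_nonneg _)

/-- A sequence that tends to zero in `X` has a subsequence that tends to zero almost everywhere. -/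
lemma X.exists_subseq_ae_tendsto_zero {h : ℕ → X} (hh : Tendsto h atTop (𝓝 0)) :
    ∃ k : ℕ → ℕ, StrictMono k ∧ ∀ᵐ x : ℝ, Tendsto (fun n => h (k n) x) atTop (𝓝 0) := by
  have h1 : Tendsto (fun n => X.toL2CLM (h n)) atTop (𝓝 0) := by
    have := (X.toL2CLM.continuous.tendsto 0).comp hh
    rwa [map_zero] at this
  obtain ⟨k, hk, hae⟩ := (tendstoInMeasure_of_tendsto_Lp h1).exists_seq_tendsto_ae
  refine ⟨k, hk, ?_⟩
  filter_upwards [hae, Lp.coeFn_zero ℝ 2 (volume : Measure ℝ)] with x hx hx0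
  rw [hx0] at hx
  exact hx

/-! ### Differentiability of the energy -/

/-- The quotient of the first-order Taylor remainder of the primitive by the increment. -/
noncomputable def remainder (f : ℝ → ℝ) (a h : ℝ) : ℝ :=
  (primitive f (a + h) - primitive f a - f a * h) / h

section Nonlinearity

variable {f : ℝ → ℝ} {α₀ : ℝ}

lemma remainder_mul (a h : ℝ) :
    remainder f a h * h = primitive f (a + h) - primitive f a - f a * h := by
  rcases eq_or_ne h 0 with rfl | hh
  · simp
  · exact div_mul_cancel₀ _ hh

lemma tendsto_remainder (hf : Continuous f) (a : ℝ) :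
    Tendsto (remainder f a) (𝓝 0) (𝓝 0) := by
  have h := (hasDerivAt_iff_isLittleO_nhds_zero.1 (hasDerivAt_primitive hf a)).tendsto_div_nhds_zero
  refine h.congr fun b => ?_
  rw [smul_eq_mul, mul_comm b, remainder]

/-- Mean value inequality: any `t` between `a` and `a + b` has `t² ≤ 2b² + 2a²`. -/
lemma abs_remainder_le (hf : Continuous f) {C α : ℝ} (hC : 0 ≤ C) (hα : 0 ≤ α)
    (h : ∀ t, |f t| ≤ C * Real.exp (α * t ^ 2)) (a b : ℝ) :
    |remainder f a b| ≤ 2 * C * Real.exp (2 * α * b ^ 2 + 2 * α * a ^ 2) := by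
  set E := Real.exp (2 * α * b ^ 2 + 2 * α * a ^ 2) with hE
  have hE0 : 0 < E := Real.exp_pos _
  have h1 : ∀ t ∈ Set.uIcc a (a + b), ‖f t‖ ≤ C * E := by
    intro t ht
    refine (h t).trans ?_
    have h2 := Set.abs_sub_left_of_mem_uIcc ht
    rw [add_sub_cancel_left] at h2
    have h3 : (t - a) ^ 2 ≤ b ^ 2 := sq_le_sq.2 h2
    have h4 : t ^ 2 ≤ 2 * b ^ 2 + 2 * a ^ 2 := by nlinarith [sq_nonneg (t - 2 * a)]
    rw [hE]
    gcongr
    nlinarith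
  have h2 := (convex_uIcc a (a + b)).norm_image_sub_le_of_norm_hasDerivWithin_le
    (fun t _ => (hasDerivAt_primitive hf t).hasDerivWithinAt) h1 Set.left_mem_uIcc
    Set.right_mem_uIcc
  rw [add_sub_cancel_left, Real.norm_eq_abs, Real.norm_eq_abs] at h2
  have h3 := h1 a Set.left_mem_uIcc
  rw [Real.norm_eq_abs] at h3
  rcases eq_or_ne b 0 with rfl | hb
  · simp only [remainder, div_zero, abs_zero]; positivity
  rw [remainder, abs_div, div_le_iff₀ (abs_pos.2 hb)]
  have h4 := abs_sub (primitive f (a + b) - primitive f a) (f a * b)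
  rw [abs_mul] at h4
  nlinarith [abs_nonneg b]

/-- That `A'` does not depend on `η` matters: it fixes the Trudinger–Moser ball and its constant
before the error `η` is chosen. -/
lemma CriticalHyp.exists_remainder_sq_le (hf : CriticalHyp f α₀) :
    ∃ A' : ℝ, 0 < A' ∧ ∀ η : ℝ, 0 < η → ∃ K B : ℝ, 0 ≤ K ∧ ∀ a h : ℝ,
      remainder f a h ^ 2 ≤ K * Real.exp (B * a ^ 2) + η * Real.exp (A' * h ^ 2) := by
  obtain ⟨C, hC0, hC⟩ := hf.exists_abs_le_exp (lt_add_one α₀)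
  have hα : 0 < α₀ + 1 := by linarith [hf.exponent_pos]
  set α := α₀ + 1
  refine ⟨4 * α + 1, by positivity, fun η hη => ?_⟩
  obtain ⟨K, B, hK, hKB⟩ := one_add_abs_mul_exp_le (A := 4 * α) (A' := 4 * α + 1) (b := 4 * α)
    (η := η / (4 * C ^ 2)) (by positivity) (by linarith) (by positivity) (by positivity)
  refine ⟨4 * C ^ 2 * K, B, by positivity, fun a h => ?_⟩
  have h1 := pow_le_pow_left₀ (abs_nonneg _) (abs_remainder_le hf.continuous hC0.le hα.le hC a h) 2
  rw [sq_abs, mul_pow, ← Real.exp_nat_mul] at h1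
  have h2 := hKB h a
  have h3 : Real.exp (4 * α * h ^ 2 + 4 * α * a ^ 2) ≤
      (1 + |h|) * Real.exp (4 * α * h ^ 2 + 4 * α * a ^ 2) :=
    le_mul_of_one_le_left (Real.exp_pos _).le (by linarith [abs_nonneg h])
  calc remainder f a h ^ 2
      ≤ (2 * C) ^ 2 * Real.exp (4 * α * h ^ 2 + 4 * α * a ^ 2) := by
        refine h1.trans (le_of_eq ?_)
        congr 2; push_cast; ring
    _ ≤ (2 * C) ^ 2 * (K * Real.exp (B * a ^ 2) +
          η / (4 * C ^ 2) * Real.exp ((4 * α + 1) * h ^ 2)) := by gcongr; linarith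
    _ = _ := by field_simp; ring

lemma measurable_remainder (hf : Continuous f) (u v : X) :
    Measurable (fun x => remainder f (u x) (v x)) := by
  have hu := u.measurable
  have hv := v.measurable
  have hF := (continuous_primitive hf).measurable
  exact (((hF.comp (hu.add hv)).sub (hF.comp hu)).sub ((hf.measurable.comp hu).mul hv)).div hv

lemma CriticalHyp.memLp_remainder (hf : CriticalHyp f α₀) (u v : X) :
    MemLp (fun x => remainder f (u x) (v x)) 2 unitMeasure := by
  have hm := measurable_remainder hf.continuous u v
  refine (memLp_two_iff_integrable_sq hm.aestronglyMeasurable).2 ?_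
  obtain ⟨A', -, h⟩ := hf.exists_remainder_sq_le
  obtain ⟨K, B, -, hKB⟩ := h 1 one_pos
  refine (((X.integrable_exp hf.omega_pos u B).const_mul K).add
    ((X.integrable_exp hf.omega_pos v A').const_mul 1)).mono'
    (hm.pow_const 2).aestronglyMeasurable (Eventually.of_forall fun x => ?_)
  rw [Real.norm_eq_abs, abs_of_nonneg (sq_nonneg _)]
  exact hKB _ _

lemma CriticalHyp.tendsto_integral_remainder_sq (hf : CriticalHyp f α₀) (u : X) {h : ℕ → X}
    (hh : Tendsto h atTop (𝓝 0)) (hae : ∀ᵐ x : ℝ, Tendsto (fun n => h n x) atTop (𝓝 0)) :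
    Tendsto (fun n => ∫ x, remainder f (u x) (h n x) ^ 2 ∂unitMeasure) atTop (𝓝 0) := by
  have hω := hf.omega_pos
  have hint : ∀ n, Integrable (fun x => remainder f (u x) (h n x) ^ 2) unitMeasure :=
    fun n => (hf.memLp_remainder u (h n)).integrable_sq
  have hlim : ∀ᵐ x ∂unitMeasure,
      Tendsto (fun n => remainder f (u x) (h n x) ^ 2) atTop (𝓝 0) := by
    refine ae_restrict_of_ae ?_
    filter_upwards [hae] with x hx
    simpa using ((tendsto_remainder hf.continuous (u x)).comp hx).pow 2
  have key := tendsto_lintegral_ofReal_of_approx_dominated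
    (fun n => (hint n).aemeasurable) hlim ?_
  · have h0 : (0 : ℝ) = ∫ _, (0 : ℝ) ∂unitMeasure := by simp
    rw [h0]
    refine tendsto_integral_of_tendsto_lintegral_abs hint (integrable_const 0) ?_
    simpa only [sub_zero, abs_sq] using key
  · intro η hη
    obtain ⟨A', hA', hr⟩ := hf.exists_remainder_sq_le
    have hρ0 : 0 < omega / (2 * A') := by positivity
    obtain ⟨C, hC0, hC⟩ := exists_lintegral_exp_le hA' hρ0 (by field_simp; linarith)
    have hηC : 0 < η / C := by positivity
    obtain ⟨K, B, hK, hKB⟩ := hr (η / C) hηC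
    refine ⟨fun x => K * Real.exp (B * u x ^ 2),
      (X.integrable_exp hω u B).const_mul K, ?_⟩
    have hsmall : Tendsto (fun n => ‖h n‖ ^ 2) atTop (𝓝 0) := by
      simpa using hh.norm.pow 2
    filter_upwards [hsmall.eventually_le_const
      (by positivity : 0 < 2 * Real.pi * (omega / (2 * A')))] with n hn
    refine ⟨fun x => η / C * Real.exp (A' * h n x ^ 2), ?_, Eventually.of_forall fun x => hKB _ _⟩
    simp only [ENNReal.ofReal_mul hηC.le]
    rw [lintegral_const_mul' _ _ ENNReal.ofReal_ne_top]
    calc _ ≤ ENNReal.ofReal (η / C) * ENNReal.ofReal C := by gcongr; exact hC _ hn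
      _ = ENNReal.ofReal η := by rw [← ENNReal.ofReal_mul hηC.le, div_mul_cancel₀ _ hC0.ne']

/-- The derivative of `u ↦ ∫₀¹ F(u) dx`. -/
noncomputable def nonlinearDeriv (f : ℝ → ℝ) (u : X)
    (h : MemLp (fun x => f (u x)) 2 unitMeasure) : X →L[ℝ] ℝ :=
  LinearMap.mkContinuous
    { toFun := fun v => ∫ x, f (u x) * v x ∂unitMeasure
      map_add' := fun v w => by
        rw [← integral_add (by exact MemLp.integrable_mul h v.memLp_unit)
          (by exact MemLp.integrable_mul h w.memLp_unit)]
        refine integral_congr_ae ?_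
        filter_upwards [ae_restrict_of_ae (X.add_ae_eq v w)] with x hx
        rw [hx, mul_add]
      map_smul' := fun c v => by
        rw [RingHom.id_apply, smul_eq_mul, ← integral_const_mul]
        refine integral_congr_ae ?_
        have : (c • v : X) =ᵐ[volume] fun x => c * v x := by
          rw [map_smul]; exact Lp.coeFn_smul _ _
        filter_upwards [ae_restrict_of_ae this] with x hx
        rw [hx]; ring }
    (√(∫ x, f (u x) ^ 2 ∂unitMeasure) * 3) fun v => by
      refine (abs_integral_mul_le_sqrt_mul_sqrt h v.memLp_unit).trans ?_
      rw [mul_assoc]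
      gcongr
      exact v.sqrt_setIntegral_sq_le

lemma nonlinearDeriv_apply (u v : X) (h : MemLp (fun x => f (u x)) 2 unitMeasure) :
    nonlinearDeriv f u h v = ∫ x, f (u x) * v x ∂unitMeasure := rfl

/-- The error is `∫ remainder · h`, which Cauchy–Schwarz and Poincaré bound by `3 ‖remainder‖₂ ‖h‖`,
and the `L²` norm of the remainder vanishes as `h → 0`. -/
lemma CriticalHyp.hasFDerivAt_integral_primitive (hf : CriticalHyp f α₀) (u : X) :
    HasFDerivAt (fun w : X => ∫ x, primitive f (w x) ∂unitMeasure)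
      (nonlinearDeriv f u (hf.memLp_comp u)) u := by
  rw [hasFDerivAt_iff_isLittleO_nhds_zero]
  have hbound : ∀ h : X, ‖(∫ x, primitive f ((u + h : X) x) ∂unitMeasure) -
      (∫ x, primitive f (u x) ∂unitMeasure) - nonlinearDeriv f u (hf.memLp_comp u) h‖ ≤
      3 * √(∫ x, remainder f (u x) (h x) ^ 2 ∂unitMeasure) * ‖h‖ := by
    intro h
    have e : (∫ x, primitive f ((u + h : X) x) ∂unitMeasure) -
        (∫ x, primitive f (u x) ∂unitMeasure) - nonlinearDeriv f u (hf.memLp_comp u) h =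
        ∫ x, remainder f (u x) (h x) * h x ∂unitMeasure := by
      have i1 : Integrable (fun x => primitive f ((u + h : X) x) - primitive f (u x)) unitMeasure :=
        (hf.integrable_primitive _).sub (hf.integrable_primitive _)
      rw [nonlinearDeriv_apply, ← integral_sub (hf.integrable_primitive _)
        (hf.integrable_primitive _), ← integral_sub i1 (hf.integrable_comp_mul u h)]
      refine integral_congr_ae ?_
      filter_upwards [ae_restrict_of_ae (X.add_ae_eq u h)] with x hx
      rw [remainder_mul, hx]
    rw [e, Real.norm_eq_abs]
    refine (abs_integral_mul_le_sqrt_mul_sqrt (hf.memLp_remainder u h) h.memLp_unit).trans ?_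
    calc _ ≤ √(∫ x, remainder f (u x) (h x) ^ 2 ∂unitMeasure) * (3 * ‖h‖) := by
          gcongr; exact h.sqrt_setIntegral_sq_le
      _ = _ := by ring
  have hlim : Tendsto (fun h : X => 3 * √(∫ x, remainder f (u x) (h x) ^ 2 ∂unitMeasure))
      (𝓝 0) (𝓝 0) := by
    -- Convergence in `X` gives a.e. convergence only along subsequences, which suffices for a
    -- limit.
    refine tendsto_of_subseq_tendsto fun h hh => ?_
    obtain ⟨k, hk, hae⟩ := X.exists_subseq_ae_tendsto_zero hh
    refine ⟨k, ?_⟩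
    simpa using
      ((hf.tendsto_integral_remainder_sq u (hh.comp hk.tendsto_atTop) hae).sqrt).const_mul 3
  refine Asymptotics.isLittleO_iff.2 fun c hc => ?_
  filter_upwards [hlim.eventually_le_const hc] with h hh
  exact (hbound h).trans (by gcongr)

/-- Ensures that `fderiv` is the true derivative and not its default value `0`. -/
lemma CriticalHyp.hasFDerivAt_energy (hf : CriticalHyp f α₀) (u : X) :
    HasFDerivAt (energy f)
      ((2 * Real.pi)⁻¹ • innerSL ℝ u - nonlinearDeriv f u (hf.memLp_comp u)) u := by
  have h1 : HasFDerivAt (fun w : X => ‖w‖ ^ 2 / (4 * Real.pi))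
      ((2 * Real.pi)⁻¹ • innerSL ℝ u) u := by
    have h2 : (2 * Real.pi)⁻¹ • innerSL ℝ u = (4 * Real.pi)⁻¹ • (2 • innerSL ℝ u) := by
      rw [two_smul, ← two_smul ℝ, smul_smul]
      congr 1
      field_simp
      norm_num
    rw [h2]
    simp only [div_eq_mul_inv]
    exact ((hasStrictFDerivAt_norm_sq u).hasFDerivAt).mul_const (4 * Real.pi)⁻¹
  exact h1.sub (hf.hasFDerivAt_integral_primitive u)

lemma CriticalHyp.fderiv_energy_apply (hf : CriticalHyp f α₀) (u v : X) :
    fderiv ℝ (energy f) u v =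
      inner ℝ u v / (2 * Real.pi) - ∫ x, f (u x) * v x ∂unitMeasure := by
  rw [(hf.hasFDerivAt_energy u).fderiv]
  simp [nonlinearDeriv_apply, div_eq_inv_mul]

lemma energy_eq (u : X) :
    energy f u = ‖u‖ ^ 2 / (4 * Real.pi) - ∫ x, primitive f (u x) ∂unitMeasure := rfl

lemma CriticalHyp.fderiv_energy_self (hf : CriticalHyp f α₀) (u : X) :
    fderiv ℝ (energy f) u u = ‖u‖ ^ 2 / (2 * Real.pi) - ∫ x, f (u x) * u x ∂unitMeasure := by
  rw [hf.fderiv_energy_apply, real_inner_self_eq_norm_sq]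

/-! ### Boundedness of Palais–Smale sequences -/

/-- Plays the role of the Ambrosetti–Rabinowitz condition, with an arbitrarily large exponent `1/ε`.
-/
lemma CriticalHyp.exists_primitive_le_add_mul (hf : CriticalHyp f α₀) {ε : ℝ} (hε : 0 < ε) :
    ∃ C : ℝ, 0 ≤ C ∧ ∀ t, primitive f t ≤ C + ε * (f t * t) := by
  obtain ⟨C, M, hC, hM, h⟩ := hf.exists_primitive_le_add
  obtain ⟨C', hC', h'⟩ := hf.exists_abs_le_add (div_pos hε hM)
  refine ⟨C + M * C', by positivity, fun t => ?_⟩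
  calc primitive f t ≤ C + M * |f t| := h t
    _ ≤ C + M * (C' + ε / M * (f t * t)) := by gcongr; exact h' t
    _ = _ := by field_simp; ring

/-- A Palais–Smale sequence is bounded. -/
lemma CriticalHyp.exists_norm_le (hf : CriticalHyp f α₀) {c : ℝ} {u : ℕ → X}
    (hJ : Tendsto (fun n => energy f (u n)) atTop (𝓝 c))
    (hD : Tendsto (fun n => fderiv ℝ (energy f) (u n)) atTop (𝓝 0)) :
    ∃ R S : ℝ, (∀ n, ‖u n‖ ≤ R) ∧ ∀ n, ∫ x, f (u n x) * u n x ∂unitMeasure ≤ S := by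
  obtain ⟨e, he⟩ := hJ.bddAbove_range
  obtain ⟨d, hd⟩ := ((tendsto_zero_iff_norm_tendsto_zero (E := X →L[ℝ] ℝ)).1 hD).bddAbove_range
  replace he : ∀ n, energy f (u n) ≤ e := fun n => he ⟨n, rfl⟩
  replace hd : ∀ n, ‖fderiv ℝ (energy f) (u n)‖ ≤ d := fun n => hd ⟨n, rfl⟩
  -- Any constant below `1/2` would do; `1/4` leaves `‖u‖²/(8π)` on the left.
  obtain ⟨C, hC0, hC⟩ := hf.exists_primitive_le_add_mul (by norm_num : (0 : ℝ) < 1 / 4)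
  have hd0 : 0 ≤ d := (ContinuousLinearMap.opNorm_nonneg _).trans (hd 0)
  have hI : ∀ n, ∫ x, f (u n x) * u n x ∂unitMeasure ≤
      ‖u n‖ ^ 2 / (2 * Real.pi) + d * ‖u n‖ := by
    intro n
    have h1 := hf.fderiv_energy_self (u n)
    have h2 := (neg_le_abs _).trans ((fderiv ℝ (energy f) (u n)).le_opNorm (u n))
    have h3 : ‖fderiv ℝ (energy f) (u n)‖ * ‖u n‖ ≤ d * ‖u n‖ := by gcongr; exact hd n
    linarith
  have hF : ∀ n, ∫ x, primitive f (u n x) ∂unitMeasure ≤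
      C + 1 / 4 * ∫ x, f (u n x) * u n x ∂unitMeasure := by
    intro n
    have i1 := (hf.integrable_comp_mul (u n) (u n)).const_mul (1 / 4)
    calc ∫ x, primitive f (u n x) ∂unitMeasure
        ≤ ∫ x, (C + 1 / 4 * (f (u n x) * u n x)) ∂unitMeasure :=
          integral_mono (hf.integrable_primitive _) ((integrable_const C).add i1) fun x => hC _
      _ = _ := by
          rw [integral_add (integrable_const C) i1, integral_const_mul]; simp
  -- If `y² ≤ q + p y` with `p, q ≥ 0`, then `y ≤ 1 + p + q`.
  set R : ℝ := 1 + 2 * Real.pi * d + 8 * Real.pi * (|e| + C) with hR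
  have hpi := Real.pi_pos
  have hbound : ∀ n, ‖u n‖ ≤ R := by
    intro n
    have h1 := energy_eq (f := f) (u n)
    have h2 := he n
    have h3 := hI n
    have h4 := hF n
    have h5 := le_abs_self e
    set y := ‖u n‖ with hy
    have hy0 : 0 ≤ y := norm_nonneg _
    have h6 : y ^ 2 / (4 * Real.pi) ≤ |e| + C + 1 / 4 * (y ^ 2 / (2 * Real.pi) + d * y) := by
      linarith
    have h7 : y ^ 2 ≤ 8 * Real.pi * (|e| + C) + 2 * Real.pi * d * y := by
      have h8 : y ^ 2 / (4 * Real.pi) - 1 / 4 * (y ^ 2 / (2 * Real.pi)) = y ^ 2 / (8 * Real.pi) := by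
        field_simp; ring
      have h9 : y ^ 2 / (8 * Real.pi) ≤ |e| + C + 1 / 4 * (d * y) := by linarith
      rw [div_le_iff₀ (by positivity)] at h9
      linarith
    by_contra hc
    push Not at hc
    have hq : 0 ≤ 8 * Real.pi * (|e| + C) := by positivity
    have hp : 0 ≤ 2 * Real.pi * d := by positivity
    have : 1 < y := by rw [hR] at hc; linarith
    nlinarith
  refine ⟨R, R ^ 2 / (2 * Real.pi) + d * R, hbound, fun n => (hI n).trans ?_⟩
  have := hbound n
  gcongr

/-! ### Passage to the limit -/

section Limit

variable {u : ℕ → X} {v : X} {S : ℝ}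

lemma ae_unit_tendsto (h : ∀ᵐ x : ℝ, Tendsto (fun n => u n x) atTop (𝓝 (v x))) {g : ℝ → ℝ}
    (hg : Continuous g) :
    ∀ᵐ x ∂unitMeasure, Tendsto (fun n => g (u n x)) atTop (𝓝 (g (v x))) := by
  refine ae_restrict_of_ae ?_
  filter_upwards [h] with x hx
  exact (hg.tendsto _).comp hx

/-- Provides the small error term in the Vitali argument, uniformly along the sequence. -/
lemma CriticalHyp.lintegral_mul_self_le (hf : CriticalHyp f α₀) {η : ℝ} (hη : 0 < η) (w : X)
    (hS : ∫ x, f (w x) * w x ∂unitMeasure ≤ S) :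
    ∫⁻ x, ENNReal.ofReal (η / (|S| + 1) * (f (w x) * w x)) ∂unitMeasure ≤ ENNReal.ofReal η := by
  rw [← ofReal_integral_eq_lintegral_ofReal ((hf.integrable_comp_mul w w).const_mul _)
    (Eventually.of_forall fun x => mul_nonneg (by positivity) (hf.mul_self_nonneg _)),
    integral_const_mul]
  refine ENNReal.ofReal_le_ofReal ?_
  rw [div_mul_eq_mul_div, div_le_iff₀ (by positivity)]
  gcongr
  linarith [le_abs_self S]

lemma CriticalHyp.tendsto_lintegral_abs_sub (hf : CriticalHyp f α₀)
    (hae : ∀ᵐ x : ℝ, Tendsto (fun n => u n x) atTop (𝓝 (v x)))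
    (hS : ∀ n, ∫ x, f (u n x) * u n x ∂unitMeasure ≤ S) {g : ℝ → ℝ} (hg : Continuous g)
    (hgi : ∀ w : X, Integrable (fun x => g (w x)) unitMeasure)
    (hgf : ∀ ε : ℝ, 0 < ε → ∃ C : ℝ, ∀ t, |g t| ≤ C + ε * (f t * t)) :
    Tendsto (fun n => ∫⁻ x, ENNReal.ofReal |g (u n x) - g (v x)| ∂unitMeasure) atTop (𝓝 0) := by
  refine tendsto_lintegral_ofReal_of_approx_dominated
    (fun n => ((hgi (u n)).sub (hgi v)).abs.aemeasurable) ?_ ?_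
  · filter_upwards [ae_unit_tendsto hae hg] with x hx
    simpa using (hx.sub_const (g (v x))).abs
  · intro η hη
    obtain ⟨C, hC⟩ := hgf (η / (|S| + 1)) (by positivity)
    refine ⟨fun x => |g (v x)| + C, (hgi v).abs.add (integrable_const C),
      Eventually.of_forall fun n => ⟨_, hf.lintegral_mul_self_le hη (u n) (hS n),
        Eventually.of_forall fun x => ?_⟩⟩
    have := abs_sub (g (u n x)) (g (v x))
    linarith [hC (u n x)]

lemma CriticalHyp.tendsto_integral_primitive (hf : CriticalHyp f α₀)
    (hae : ∀ᵐ x : ℝ, Tendsto (fun n => u n x) atTop (𝓝 (v x)))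
    (hS : ∀ n, ∫ x, f (u n x) * u n x ∂unitMeasure ≤ S) :
    Tendsto (fun n => ∫ x, primitive f (u n x) ∂unitMeasure) atTop
      (𝓝 (∫ x, primitive f (v x) ∂unitMeasure)) := by
  refine tendsto_integral_of_tendsto_lintegral_abs (fun n => hf.integrable_primitive _)
    (hf.integrable_primitive _) ?_
  refine hf.tendsto_lintegral_abs_sub hae hS (continuous_primitive hf.continuous)
    hf.integrable_primitive fun ε hε => ?_
  obtain ⟨C, -, hC⟩ := hf.exists_primitive_le_add_mul hε
  exact ⟨C, fun t => by rw [abs_of_nonneg (hf.primitive_nonneg t)]; exact hC t⟩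

/-- Only `L¹` convergence of `f(u_n)` is available at this stage, so the test function has to be
bounded. -/
lemma CriticalHyp.tendsto_integral_mul_trunc (hf : CriticalHyp f α₀)
    (hae : ∀ᵐ x : ℝ, Tendsto (fun n => u n x) atTop (𝓝 (v x)))
    (hS : ∀ n, ∫ x, f (u n x) * u n x ∂unitMeasure ≤ S) (k : ℕ) :
    Tendsto (fun n => ∫ x, f (u n x) * X.trunc k v x ∂unitMeasure) atTop
      (𝓝 (∫ x, f (v x) * X.trunc k v x ∂unitMeasure)) := by
  refine tendsto_integral_of_tendsto_lintegral_abs (fun n => hf.integrable_comp_mul _ _)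
    (hf.integrable_comp_mul _ _) ?_
  have h := hf.tendsto_lintegral_abs_sub hae hS hf.continuous hf.integrable_comp fun ε hε =>
    (hf.exists_abs_le_add hε).imp fun _ hC => hC.2
  have h2 := ENNReal.Tendsto.const_mul (a := ENNReal.ofReal k) h (Or.inr ENNReal.ofReal_ne_top)
  rw [mul_zero] at h2
  refine tendsto_of_tendsto_of_tendsto_of_le_of_le tendsto_const_nhds h2 (fun _ => zero_le)
    fun n => ?_
  simp only
  rw [← lintegral_const_mul' _ _ ENNReal.ofReal_ne_top]
  refine lintegral_mono_ae (ae_restrict_of_ae ?_)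
  filter_upwards [X.trunc_ae_eq k v] with x hx
  rw [hx, ← ENNReal.ofReal_mul (Nat.cast_nonneg k), ← sub_mul, abs_mul, mul_comm]
  exact ENNReal.ofReal_le_ofReal (by gcongr; exact abs_trunc_le _ _)

lemma tendsto_fderiv_apply {u w : ℕ → X} {R : ℝ} (hw : ∀ n, ‖w n‖ ≤ R)
    (hD : Tendsto (fun n => fderiv ℝ (energy f) (u n)) atTop (𝓝 0)) :
    Tendsto (fun n => fderiv ℝ (energy f) (u n) (w n)) atTop (𝓝 0) := by
  have h : Tendsto (fun n => ‖fderiv ℝ (energy f) (u n)‖ * R) atTop (𝓝 0) := by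
    simpa using ((tendsto_zero_iff_norm_tendsto_zero (E := X →L[ℝ] ℝ)).1 hD).mul_const R
  refine squeeze_zero_norm (fun n => ?_) h
  exact (ContinuousLinearMap.le_opNorm _ _).trans (by gcongr; exact hw n)

/-- The weak limit of a Palais–Smale sequence has nonnegative energy. -/
lemma CriticalHyp.energy_limit_nonneg (hf : CriticalHyp f α₀) {R : ℝ} (hR : ∀ n, ‖u n‖ ≤ R)
    (hae : ∀ᵐ x : ℝ, Tendsto (fun n => u n x) atTop (𝓝 (v x)))
    (hS : ∀ n, ∫ x, f (u n x) * u n x ∂unitMeasure ≤ S)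
    (hD : Tendsto (fun n => fderiv ℝ (energy f) (u n)) atTop (𝓝 0)) : 0 ≤ energy f v := by
  have h1 : ∀ k, fderiv ℝ (energy f) v (X.trunc k v) = 0 := by
    intro k
    refine tendsto_nhds_unique ?_
      (tendsto_fderiv_apply (w := fun _ => X.trunc k v) (fun _ => le_rfl) hD)
    simp only [hf.fderiv_energy_apply]
    exact ((X.tendsto_inner_of_ae_tendsto hR hae _).div_const _).sub
      (hf.tendsto_integral_mul_trunc hae hS k)
  -- Continuity of `φ'(v)` and density of truncations. Then `φ(v) = ½ ∫ (f(v)v - 2F(v)) ≥ 0`.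
  have h2 : fderiv ℝ (energy f) v v = 0 := by
    refine tendsto_nhds_unique
      (((fderiv ℝ (energy f) v).continuous.tendsto v).comp v.tendsto_trunc) ?_
    simp [Function.comp_def, h1]
  rw [hf.fderiv_energy_self] at h2
  have h3 : 2 * ∫ x, primitive f (v x) ∂unitMeasure ≤ ∫ x, f (v x) * v x ∂unitMeasure := by
    rw [← integral_const_mul]
    exact integral_mono ((hf.integrable_primitive v).const_mul 2) (hf.integrable_comp_mul v v)
      fun x => hf.two_mul_primitive_le _
  rw [energy_eq]
  have h4 : ‖v‖ ^ 2 / (4 * Real.pi) = ‖v‖ ^ 2 / (2 * Real.pi) / 2 := by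
    rw [div_div]; congr 1; ring
  rw [h4]
  linarith

lemma tendsto_norm_sub_sq {L : ℝ}
    (hL : Tendsto (fun n => ‖u n‖ ^ 2) atTop (𝓝 L))
    (hw : Tendsto (fun n => inner ℝ (u n) v) atTop (𝓝 (inner ℝ v v))) :
    Tendsto (fun n => ‖u n - v‖ ^ 2) atTop (𝓝 (L - ‖v‖ ^ 2)) := by
  simp only [norm_sub_sq_real]
  have := (hL.sub (hw.const_mul 2)).add_const (‖v‖ ^ 2)
  rw [real_inner_self_eq_norm_sq] at this
  convert this using 2
  ring

/-- Below the critical level the nonlinear term is compact. -/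
lemma CriticalHyp.tendsto_integral_mul_sub (hf : CriticalHyp f α₀)
    (hae : ∀ᵐ x : ℝ, Tendsto (fun n => u n x) atTop (𝓝 (v x))) {ρ : ℝ} (hρ : 0 < ρ)
    (hρω : α₀ * ρ < omega) (hu : ∀ᶠ n in atTop, ‖u n - v‖ ^ 2 ≤ 2 * Real.pi * ρ) :
    Tendsto (fun n => ∫ x, f (u n x) * (u n - v : X) x ∂unitMeasure) atTop (𝓝 0) := by
  have hα₀ := hf.exponent_pos
  have hω := hf.omega_pos
  -- The chain is `α₀ < α < A < A' < ω/ρ`: `α` bounds `f`, the step to `A` pays for the cross term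
  -- in `(w + s)²`, the step to `A'` for the factor `1 + |w|` and the smallness.
  obtain ⟨A', hA1, hA2⟩ := exists_between ((lt_div_iff₀ hρ).2 hρω)
  obtain ⟨A, hA3, hA4⟩ := exists_between hA1
  obtain ⟨α, hα1, hα2⟩ := exists_between hA3
  have hα0 : 0 < α := hα₀.trans hα1
  obtain ⟨C, hC0, hC⟩ := hf.exists_abs_le_exp hα1
  obtain ⟨H, hH0, hH⟩ := exists_lintegral_exp_le (by linarith) hρ ((lt_div_iff₀ hρ).1 hA2)
  -- Makes `A w² + b s² - α(w + s)²` a nonnegative multiple of a square.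
  set b : ℝ := α + α ^ 2 / (A - α) with hb
  have hAα : 0 < A - α := sub_pos.2 hα2
  have hquad : ∀ w s : ℝ, α * (w + s) ^ 2 ≤ A * w ^ 2 + b * s ^ 2 := by
    intro w s
    have e : A * w ^ 2 + b * s ^ 2 - α * (w + s) ^ 2 =
        (A - α)⁻¹ * ((A - α) * w - α * s) ^ 2 := by
      rw [hb]; field_simp; ring
    have : 0 ≤ (A - α)⁻¹ * ((A - α) * w - α * s) ^ 2 := by positivity
    linarith
  have hsub : ∀ᵐ x ∂unitMeasure, ∀ n, (u n - v : X) x = u n x - v x :=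
    ae_restrict_of_ae (ae_all_iff.2 fun n => X.sub_ae_eq (u n) v)
  have h0 : (0 : ℝ) = ∫ _, (0 : ℝ) ∂unitMeasure := by simp
  rw [h0]
  refine tendsto_integral_of_tendsto_lintegral_abs (fun n => hf.integrable_comp_mul _ _)
    (integrable_const 0) ?_
  simp only [sub_zero]
  refine tendsto_lintegral_ofReal_of_approx_dominated
    (fun n => (hf.integrable_comp_mul _ _).abs.aemeasurable) ?_ fun η hη => ?_
  · filter_upwards [hsub, ae_unit_tendsto hae hf.continuous, ae_unit_tendsto hae continuous_id]
      with x h1 h2 h3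
    simp only [h1]
    simpa using (h2.mul (h3.sub_const (v x))).abs
  · have hη' : 0 < η / (C * H) := by positivity
    obtain ⟨K, B, hK, hKB⟩ := one_add_abs_mul_exp_le (A := A) (A' := A') (b := b)
      (by linarith) hA4 (by positivity) hη'
    refine ⟨fun x => C * (K * Real.exp (B * v x ^ 2)),
      ((X.integrable_exp hω v B).const_mul K).const_mul C, ?_⟩
    filter_upwards [hu] with n hn
    refine ⟨fun x => η / H * Real.exp (A' * (u n - v : X) x ^ 2), ?_, ?_⟩
    · have hηH : 0 ≤ η / H := by positivity
      simp only [ENNReal.ofReal_mul hηH]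
      rw [lintegral_const_mul' _ _ ENNReal.ofReal_ne_top]
      calc _ ≤ ENNReal.ofReal (η / H) * ENNReal.ofReal H := by gcongr; exact hH _ hn
        _ = ENNReal.ofReal η := by rw [← ENNReal.ofReal_mul hηH, div_mul_cancel₀ _ hH0.ne']
    · filter_upwards [hsub] with x hx
      set w := (u n - v : X) x with hw
      have e1 : u n x = w + v x := by rw [hw, hx n]; ring
      have h1 : |f (u n x)| ≤ C * Real.exp (A * w ^ 2 + b * v x ^ 2) := by
        refine (hC _).trans ?_
        rw [e1]
        gcongr
        exact hquad _ _
      calc |f (u n x) * w| = |f (u n x)| * |w| := abs_mul _ _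
        _ ≤ C * Real.exp (A * w ^ 2 + b * v x ^ 2) * (1 + |w|) := by
          gcongr; linarith
        _ = C * ((1 + |w|) * Real.exp (A * w ^ 2 + b * v x ^ 2)) := by ring
        _ ≤ C * (K * Real.exp (B * v x ^ 2) + η / (C * H) * Real.exp (A' * w ^ 2)) := by
          gcongr; exact hKB _ _
        _ = _ := by field_simp

end Limit

end Nonlinearity

end HalfLap

/-! ### The Palais–Smale condition -/

theorem lemma4p1 (f : ℝ → ℝ) (α₀ : ℝ) (hf : HalfLap.CriticalHyp f α₀)
    (c : ℝ) (hc : c < HalfLap.omega / (2 * α₀)) :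
    HalfLap.PalaisSmaleAt (HalfLap.energy f) c := by
  intro u hJ hD
  obtain ⟨R, S, hR, hS⟩ := hf.exists_norm_le hJ hD
  obtain ⟨v, k, hk, hae⟩ := HalfLap.X.exists_subseq_ae_tendsto hR
  refine ⟨v, k, hk, ?_⟩
  replace hJ := hJ.comp hk.tendsto_atTop
  replace hD := hD.comp hk.tendsto_atTop
  replace hR : ∀ n, ‖u (k n)‖ ≤ R := fun n => hR (k n)
  replace hS := fun n => hS (k n)
  have hα₀ := hf.exponent_pos
  have hω := hf.omega_pos
  have hpi := Real.pi_pos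
  have hv := hf.energy_limit_nonneg hR hae hS hD
  have hweak := HalfLap.X.tendsto_inner_of_ae_tendsto hR hae v
  have hnorm : Tendsto (fun n => ‖u (k n)‖ ^ 2) atTop (𝓝 (4 * Real.pi *
      (c + ∫ x, HalfLap.primitive f (v x) ∂HalfLap.unitMeasure))) := by
    refine ((hJ.add (hf.tendsto_integral_primitive hae hS)).const_mul (4 * Real.pi)).congr
      fun n => ?_
    simp only [Function.comp_apply, HalfLap.energy_eq, sub_add_cancel]
    field_simp
  have hdist := HalfLap.tendsto_norm_sub_sq hnorm hweak
  -- `‖u_n - v‖²` tends to `4π(c - φ(v)) ≤ 4πc < 2πρ`, while `α₀ρ < ω`; the maximum with `0` keeps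
  -- `ρ` positive whatever the sign of `c`.
  obtain ⟨ρ, hρ1, hρ2⟩ : ∃ ρ, max (2 * c) 0 < ρ ∧ ρ < HalfLap.omega / α₀ := by
    refine exists_between (max_lt ?_ (by positivity))
    rw [lt_div_iff₀ (by positivity)] at hc ⊢
    linarith
  have hρ0 : 0 < ρ := (le_max_right _ _).trans_lt hρ1
  have hsmall : ∀ᶠ n in atTop, ‖u (k n) - v‖ ^ 2 ≤ 2 * Real.pi * ρ := by
    refine hdist.eventually_le_const ?_
    rw [HalfLap.energy_eq, sub_nonneg, le_div_iff₀ (by positivity)] at hv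
    have h1 : 2 * c < ρ := (le_max_left _ _).trans_lt hρ1
    nlinarith
  have hnl := hf.tendsto_integral_mul_sub hae hρ0
    (by rw [lt_div_iff₀ hα₀] at hρ2; linarith) hsmall
  have hder := HalfLap.tendsto_fderiv_apply (w := fun n => u (k n) - v) (R := R + ‖v‖)
    (fun n => (norm_sub_le _ _).trans (by gcongr; exact hR n)) hD
  have hinner : Tendsto (fun n => inner ℝ (u (k n)) (u (k n) - v)) atTop (𝓝 0) := by
    have := (hder.add hnl).const_mul (2 * Real.pi)
    simp only [add_zero, mul_zero] at this
    refine this.congr fun n => ?_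
    simp only [hf.fderiv_energy_apply, sub_add_cancel]
    field_simp
  rw [tendsto_iff_norm_sub_tendsto_zero]
  suffices h : Tendsto (fun n => ‖u (k n) - v‖ ^ 2) atTop (𝓝 0) by
    simpa [Real.sqrt_sq (norm_nonneg _)] using h.sqrt
  -- `‖u_n - v‖² = ⟨u_n, u_n - v⟩ - ⟨u_n, v⟩ + ⟨v, v⟩`.
  have := (hinner.sub hweak).add_const (inner ℝ v v)
  rw [zero_sub, neg_add_cancel] at this
  refine this.congr fun n => ?_
  rw [← real_inner_self_eq_norm_sq, inner_sub_left (u (k n)) v (u (k n) - v),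
    inner_sub_right v, real_inner_comm v (u (k n))]
  ring
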